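/- \textbf{Theorem (general Poynting theorem).} Let $V$ be a four-dimensional smooth manifold with a smooth Lorentzian metric $g_{ab}$ of signature $(-,+,+,+)$, Levi-Civita connection $\nabla_a$ and smooth volume element $\eta_{abcd}$, and let $n^a$ be a smooth vector field with $n_an^a=-1$. Let $F_{ab}$ be a smooth antisymmetric tensor field (Maxwell's equations are not assumed) and $j^a$ a smooth vector field, and put $$T_{ab}=F_{ad}F_b{}^{d}-\tfrac14 g_{ab}F_{cd}F^{cd},\qquad F^*_{ab}=\tfrac12\eta_{abcd}F^{cd}.$$ Put $h_{ab}=g_{ab}+n_an_b$ and $\varepsilon_{abc}=n^d\eta_{dabc}$. Let $D_a$ be the Cattaneo operator: $D_a$ of a tensor is $\nabla_a$ of it with all indices, including $a$, projected by $h$. Let $\pounds_n$ be the Lie derivative along $n^a$. The kinematical quantities are $$A^b=n^a\nabla_an^b,\quad \theta=\nabla_an^a,\quad \omega_{ab}=h_{[a}{}^{d}h_{b]}{}^{c}\nabla_dn_c,\quad \sigma_{ab}=h_{(a}{}^{d}h_{b)}{}^{c}\nabla_dn_c-\tfrac{\theta}{3}h_{ab},\quad \omega_a=\tfrac12\varepsilon_{abc}\omega^{bc}.$$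 The electromagnetic quantities are $$E_a=F_{ab}n^b,\quad B_a=F^*_{ab}n^b,\quad U=\tfrac12(E_aE^a+B_aB^a),\quad P_a=\varepsilon_{abc}B^bE^c,$$ $$\mathcal T_{ab}=Uh_{ab}-E_aE_b-B_aB_b,\quad \rho=-j^an_a,\quad J^a=-h^{ac}j_c,$$ so that $j^a=\rho n^a-J^a$. Then the equations $$\nabla_bT^b{}_a=F_a{}^{b}j_b,\qquad \nabla_aj^a=0$$ hold on $V$ if and only if the following three equations hold on $V$: $$\pounds_nU=-E^aJ_a-2A^aP_a-\tfrac43U\theta-\mathcal T^{ab}\sigma_{ab}-D_aP^a,$$ $$\pounds_nP_a=-\varepsilon_{abc}B^bJ^c+E_a\rho+2\varepsilon_{abc}P^b\omega^c-P_a\theta-A^b(Uh_{ab}+\mathcal T_{ab})-D_b\mathcal T^b{}_a,$$ $$\pounds_n\rho=A^aJ_a-\theta\rho+D_aJ^a.$$ -/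

import Mathlib

open scoped Manifold ContDiff

noncomputable section

namespace Poynting

/-- The coordinate space of a four-dimensional manifold. -/
abbrev Coord : Type := EuclideanSpace ℝ (Fin 4)

/-- The coordinate partial derivative `∂_a f` at `y`. -/
def pd (f : Coord → ℝ) (y : Coord) (a : Fin 4) : ℝ :=
  fderiv ℝ f y (EuclideanSpace.single a 1)

/-!
## Tensor calculus in a coordinate system

`Fields` collects the components, as functions of the coordinates, of the metric `g_ab`, the volume
element `η_abcd`, the observer field `n^a`, the Faraday tensor `F_ab` and the charge current `j^a`
in one coordinate system. All other quantities are computed from these. Arguments are in the order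
of the indices of the tensor (for a derivative, the derivative index comes first).
-/

/-- Components of the fundamental fields in a coordinate system. -/
structure Fields where
  /-- `g_ab` -/
  g : Coord → Matrix (Fin 4) (Fin 4) ℝ
  /-- `η_abcd` -/
  η : Coord → Fin 4 → Fin 4 → Fin 4 → Fin 4 → ℝ
  /-- `n^a` -/
  n : Coord → Fin 4 → ℝ
  /-- `F_ab` -/
  F : Coord → Fin 4 → Fin 4 → ℝ
  /-- `j^a` -/
  j : Coord → Fin 4 → ℝ

namespace Fields

/-- The inverse metric `g^ab`. -/
def gUp (S : Fields) (y : Coord) (a b : Fin 4) : ℝ := (S.g y)⁻¹ a b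

/-- `X_a = g_ab X^b`. -/
def lower (S : Fields) (X : Coord → Fin 4 → ℝ) (y : Coord) (a : Fin 4) : ℝ :=
  ∑ b, S.g y a b * X y b

/-- `L^a = g^ab L_b`. -/
def raise (S : Fields) (L : Coord → Fin 4 → ℝ) (y : Coord) (a : Fin 4) : ℝ :=
  ∑ b, S.gUp y a b * L y b

/-- `T^a_b = g^ac T_cb`. -/
def raiseFirst (S : Fields) (T : Coord → Fin 4 → Fin 4 → ℝ) (y : Coord) (a b : Fin 4) : ℝ :=
  ∑ c, S.gUp y a c * T y c b

/-- `T_a^b = g^bc T_ac`. -/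
def raiseSecond (S : Fields) (T : Coord → Fin 4 → Fin 4 → ℝ) (y : Coord) (a b : Fin 4) : ℝ :=
  ∑ c, S.gUp y b c * T y a c

/-- `T^ab = g^ac g^bd T_cd`. -/
def raiseBoth (S : Fields) (T : Coord → Fin 4 → Fin 4 → ℝ) (y : Coord) (a b : Fin 4) : ℝ :=
  ∑ c, ∑ d, S.gUp y a c * S.gUp y b d * T y c d

/-! ### The Levi-Civita connection -/

/-- The Christoffel symbols `Γ^c_ab = ½ g^cd (∂_a g_db + ∂_b g_da - ∂_d g_ab)`. -/
def christoffel (S : Fields) (y : Coord) (c a b : Fin 4) : ℝ :=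
  (1 / 2) * ∑ d, S.gUp y c d *
    (pd (fun z => S.g z d b) y a + pd (fun z => S.g z d a) y b - pd (fun z => S.g z a b) y d)

/-- `∇_a X^b` for a vector field `X^b`. -/
def nablaVec (S : Fields) (X : Coord → Fin 4 → ℝ) (y : Coord) (a b : Fin 4) : ℝ :=
  pd (fun z => X z b) y a + ∑ c, S.christoffel y b a c * X y c

/-- `∇_a L_b` for a covector field `L_b`. -/
def nablaCov (S : Fields) (L : Coord → Fin 4 → ℝ) (y : Coord) (a b : Fin 4) : ℝ :=
  pd (fun z => L z b) y a - ∑ c, S.christoffel y c a b * L y c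

/-- `∇_c T^b_a` for a mixed tensor field `T^b_a`, with arguments in the order `c b a`. -/
def nablaMixed (S : Fields) (T : Coord → Fin 4 → Fin 4 → ℝ) (y : Coord) (c b a : Fin 4) : ℝ :=
  pd (fun z => T z b a) y c + (∑ d, S.christoffel y b c d * T y d a)
    - ∑ d, S.christoffel y d c a * T y b d

/-! ### Lie derivatives along the observer field -/

/-- `£_n f = n^a ∂_a f`. -/
def lieScalar (S : Fields) (f : Coord → ℝ) (y : Coord) : ℝ :=
  ∑ a, S.n y a * pd f y a

/-- `£_n L_a = n^b ∂_b L_a + L_b ∂_a n^b`. -/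
def lieCov (S : Fields) (L : Coord → Fin 4 → ℝ) (y : Coord) (a : Fin 4) : ℝ :=
  ∑ b, (S.n y b * pd (fun z => L z a) y b + L y b * pd (fun z => S.n z b) y a)

/-! ### The orthogonal splitting -/

/-- `n_a`. -/
def nDown (S : Fields) : Coord → Fin 4 → ℝ := S.lower S.n

/-- The spatial metric `h_ab = g_ab + n_a n_b`. -/
def h (S : Fields) (y : Coord) (a b : Fin 4) : ℝ := S.g y a b + S.nDown y a * S.nDown y b

/-- The orthogonal projector `h^a_b`; it also serves for `h_b^a`, as `h_ab` is symmetric. -/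
def hMix (S : Fields) : Coord → Fin 4 → Fin 4 → ℝ := S.raiseFirst S.h

/-- `h^ab`. -/
def hUp (S : Fields) : Coord → Fin 4 → Fin 4 → ℝ := S.raiseBoth S.h

/-- The Cattaneo operator on vector fields, `D_a X^b = h_a^c h^b_d ∇_c X^d`. -/
def cattaneoVec (S : Fields) (X : Coord → Fin 4 → ℝ) (y : Coord) (a b : Fin 4) : ℝ :=
  ∑ c, ∑ d, S.hMix y c a * S.hMix y b d * S.nablaVec X y c d

/-- The Cattaneo operator on mixed tensor fields, `D_c T^b_a = h_c^f h^b_d h_a^e ∇_f T^d_e`,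
with arguments in the order `c b a`. -/
def cattaneoMixed (S : Fields) (T : Coord → Fin 4 → Fin 4 → ℝ) (y : Coord) (c b a : Fin 4) : ℝ :=
  ∑ f, ∑ d, ∑ e, S.hMix y f c * S.hMix y b d * S.hMix y e a * S.nablaMixed T y f d e

/-- The spatial volume element `ε_abc = n^d η_dabc`. -/
def eps (S : Fields) (y : Coord) (a b c : Fin 4) : ℝ := ∑ d, S.n y d * S.η y d a b c

/-! ### Kinematical quantities -/

/-- The acceleration `A^b = n^a ∇_a n^b`. -/
def accel (S : Fields) (y : Coord) (b : Fin 4) : ℝ := ∑ a, S.n y a * S.nablaVec S.n y a b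

/-- The expansion `θ = ∇_a n^a`. -/
def expansion (S : Fields) (y : Coord) : ℝ := ∑ a, S.nablaVec S.n y a a

/-- `h_a^d h_b^c ∇_d n_c`. -/
def projGrad (S : Fields) (y : Coord) (a b : Fin 4) : ℝ :=
  ∑ d, ∑ c, S.hMix y d a * S.hMix y c b * S.nablaCov S.nDown y d c

/-- The rotation `ω_ab`. -/
def rotation (S : Fields) (y : Coord) (a b : Fin 4) : ℝ :=
  (1 / 2) * (S.projGrad y a b - S.projGrad y b a)

/-- The shear `σ_ab`. -/
def shear (S : Fields) (y : Coord) (a b : Fin 4) : ℝ :=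
  (1 / 2) * (S.projGrad y a b + S.projGrad y b a) - S.expansion y / 3 * S.h y a b

/-- The vorticity `ω_a = ½ ε_abc ω^bc`. -/
def vorticity (S : Fields) (y : Coord) (a : Fin 4) : ℝ :=
  (1 / 2) * ∑ b, ∑ c, S.eps y a b c * S.raiseBoth S.rotation y b c

/-! ### Electromagnetic quantities -/

/-- The Hodge dual `F*_ab = ½ η_abcd F^cd`. -/
def FDual (S : Fields) (y : Coord) (a b : Fin 4) : ℝ :=
  (1 / 2) * ∑ c, ∑ d, S.η y a b c d * S.raiseBoth S.F y c d

/-- The energy-momentum tensor `T_ab = F_ad F_b^d - ¼ g_ab F_cd F^cd`. -/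
def energyMomentum (S : Fields) (y : Coord) (a b : Fin 4) : ℝ :=
  (∑ d, S.F y a d * S.raiseSecond S.F y b d)
    - (1 / 4) * S.g y a b * ∑ c, ∑ d, S.F y c d * S.raiseBoth S.F y c d

/-- The electric part `E_a = F_ab n^b`. -/
def E (S : Fields) (y : Coord) (a : Fin 4) : ℝ := ∑ b, S.F y a b * S.n y b

/-- The magnetic part `B_a = F*_ab n^b`. -/
def B (S : Fields) (y : Coord) (a : Fin 4) : ℝ := ∑ b, S.FDual y a b * S.n y b

/-- The energy density `U = ½ (E_a E^a + B_a B^a)`. -/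
def U (S : Fields) (y : Coord) : ℝ :=
  (1 / 2) * ((∑ a, S.E y a * S.raise S.E y a) + ∑ a, S.B y a * S.raise S.B y a)

/-- The Poynting vector, with index down: `P_a = ε_abc B^b E^c`. -/
def P (S : Fields) (y : Coord) (a : Fin 4) : ℝ :=
  ∑ b, ∑ c, S.eps y a b c * S.raise S.B y b * S.raise S.E y c

/-- The stress tensor `𝒯_ab = U h_ab - E_a E_b - B_a B_b`. -/
def stress (S : Fields) (y : Coord) (a b : Fin 4) : ℝ :=
  S.U y * S.h y a b - S.E y a * S.E y b - S.B y a * S.B y b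

/-- The charge density `ρ = - j^a n_a`. -/
def ρ (S : Fields) (y : Coord) : ℝ := - ∑ a, S.j y a * S.nDown y a

/-- The spatial charge current `J^a = - h^ac j_c`. -/
def J (S : Fields) (y : Coord) (a : Fin 4) : ℝ := - ∑ c, S.hUp y a c * S.lower S.j y c

/-! ### The two systems of equations -/

/-- The covariant system at a point: `∇_b T^b_a = F_a^b j_b` and `∇_a j^a = 0`. -/
def CovariantLaws (S : Fields) (y : Coord) : Prop :=
  (∀ a, ∑ b, S.nablaMixed (S.raiseFirst S.energyMomentum) y b b a
      = ∑ b, S.raiseSecond S.F y a b * S.lower S.j y b) ∧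
  ∑ a, S.nablaVec S.j y a a = 0

/-- `£_n U = - E^a J_a - 2 A^a P_a - (4/3) U θ - 𝒯^ab σ_ab - D_a P^a`. -/
def EnergyLaw (S : Fields) (y : Coord) : Prop :=
  S.lieScalar S.U y =
    - (∑ a, S.raise S.E y a * S.lower S.J y a)
    - 2 * (∑ a, S.accel y a * S.P y a)
    - 4 / 3 * S.U y * S.expansion y
    - (∑ a, ∑ b, S.raiseBoth S.stress y a b * S.shear y a b)
    - ∑ a, S.cattaneoVec (S.raise S.P) y a a

/-- `£_n P_a = - ε_abc B^b J^c + E_a ρ + 2 ε_abc P^b ω^c - P_a θ - A^b (U h_ab + 𝒯_ab) - D_b 𝒯^b_a`. -/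
def MomentumLaw (S : Fields) (y : Coord) : Prop :=
  ∀ a, S.lieCov S.P y a =
    - (∑ b, ∑ c, S.eps y a b c * S.raise S.B y b * S.J y c)
    + S.E y a * S.ρ y
    + 2 * (∑ b, ∑ c, S.eps y a b c * S.raise S.P y b * S.raise S.vorticity y c)
    - S.P y a * S.expansion y
    - (∑ b, S.accel y b * (S.U y * S.h y a b + S.stress y a b))
    - ∑ b, S.cattaneoMixed (S.raiseFirst S.stress) y b b a

/-- `£_n ρ = A^a J_a - θ ρ + D_a J^a`. -/
def ChargeLaw (S : Fields) (y : Coord) : Prop :=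
  S.lieScalar S.ρ y =
    (∑ a, S.accel y a * S.lower S.J y a) - S.expansion y * S.ρ y
    + ∑ a, S.cattaneoVec S.J y a a

end Fields

/-! ## Fields on the spacetime manifold -/

section Manifold

variable {V : Type*} [TopologicalSpace V] [ChartedSpace Coord V] [IsManifold (𝓡 4) ∞ V]

/-- The coordinate vector `∂_a`, at the point with coordinates `y`, of the coordinate system `e`. -/
def coordVec (e : OpenPartialHomeomorph V Coord) (y : Coord) (a : Fin 4) :
    TangentSpace (𝓡 4) (e.symm y) :=
  mfderiv 𝓘(ℝ, Coord) (𝓡 4) e.symm y (EuclideanSpace.single a (1 : ℝ))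

/-- The components `X^a` of a vector field in the coordinate system `e`, as functions of the
coordinates: those of its pullback to coordinate space. -/
def vecComp (e : OpenPartialHomeomorph V Coord) (X : (x : V) → TangentSpace (𝓡 4) x)
    (y : Coord) (a : Fin 4) : ℝ :=
  (show Coord from VectorField.mpullback 𝓘(ℝ, Coord) (𝓡 4) e.symm X y) a

/-- A vector field is smooth. -/
def IsSmoothVec (X : (x : V) → TangentSpace (𝓡 4) x) : Prop :=
  ContMDiff (𝓡 4) (𝓡 4).tangent ∞ (fun x => (⟨x, X x⟩ : TangentBundle (𝓡 4) V))

/-- A covariant tensor field of rank `k` is smooth: so are its components in every smooth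
coordinate system. -/
def IsSmoothCov {k : ℕ}
    (T : (x : V) → MultilinearMap ℝ (fun _ : Fin k => TangentSpace (𝓡 4) x) ℝ) : Prop :=
  ∀ e ∈ IsManifold.maximalAtlas (𝓡 4) ∞ V, ∀ i : Fin k → Fin 4,
    ContDiffOn ℝ ∞ (fun y => T (e.symm y) (fun l => coordVec e y (i l))) e.target

/-- `g` is a smooth Lorentzian metric of signature `(-,+,+,+)`. -/
structure IsLorentzMetric
    (g : (x : V) → MultilinearMap ℝ (fun _ : Fin 2 => TangentSpace (𝓡 4) x) ℝ) : Prop where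
  smooth : IsSmoothCov g
  symm : ∀ x (u v : TangentSpace (𝓡 4) x), g x ![u, v] = g x ![v, u]
  signature : ∀ x, ∃ b : Module.Basis (Fin 4) ℝ (TangentSpace (𝓡 4) x), ∀ i k,
    g x ![b i, b k] = if i = k then (if i = 0 then -1 else 1) else 0

/-- `η` is a smooth volume element of the Lorentzian metric `g`: an alternating 4-form with
`η(v₀, v₁, v₂, v₃)² = - det g(vᵢ, vₖ)`; equivalently, its values on `g`-orthonormal bases
are `±1`. -/
structure IsVolumeElement
    (g : (x : V) → MultilinearMap ℝ (fun _ : Fin 2 => TangentSpace (𝓡 4) x) ℝ)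
    (η : (x : V) → TangentSpace (𝓡 4) x [⋀^Fin 4]→ₗ[ℝ] ℝ) : Prop where
  smooth : IsSmoothCov (fun x => (η x).toMultilinearMap)
  sq_eq : ∀ x (v : Fin 4 → TangentSpace (𝓡 4) x),
    (η x v) ^ 2 = - Matrix.det (Matrix.of fun i k => g x ![v i, v k])

/-- The components of all fields in the coordinate system `e`. -/
def fieldsIn (e : OpenPartialHomeomorph V Coord)
    (g : (x : V) → MultilinearMap ℝ (fun _ : Fin 2 => TangentSpace (𝓡 4) x) ℝ)
    (η : (x : V) → TangentSpace (𝓡 4) x [⋀^Fin 4]→ₗ[ℝ] ℝ)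
    (n : (x : V) → TangentSpace (𝓡 4) x)
    (F : (x : V) → TangentSpace (𝓡 4) x [⋀^Fin 2]→ₗ[ℝ] ℝ)
    (j : (x : V) → TangentSpace (𝓡 4) x) : Fields where
  g := fun y => Matrix.of fun a b => g (e.symm y) ![coordVec e y a, coordVec e y b]
  η := fun y a b c d =>
    η (e.symm y) ![coordVec e y a, coordVec e y b, coordVec e y c, coordVec e y d]
  n := vecComp e n
  F := fun y a b => F (e.symm y) ![coordVec e y a, coordVec e y b]
  j := vecComp e j

end Manifold

end Poynting

end

/-!
The components of `∇_b T^b_a - F_a^b j_b` along the observer and orthogonal to it are, up to sign,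
the defects of the energy law and of the momentum law, and `∇_a j^a` is the defect of the charge
law. As a covector vanishes exactly when its component along `n` and its spatial projection do,
the two systems are equivalent, even at a single point of a single chart
(`IsRegularAt.covariantLaws_iff`).

The algebra behind this is the decomposition `T_ab = U n_a n_b + n_a P_b + P_a n_b + 𝒯_ab`
(`IsAdaptedFrame.energyMomentum_eq`), together with the splitting `F_ab = n_a E_b - E_a n_b -
ε_abc B^c` (`IsAdaptedFrame.F_eq`), from which the Lorentz force density is read off, and the
duality between `ω_ab` and `ω_a` (`IsAdaptedFrame.eq_eps_dual`). These identities are tensorial,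
so they are checked in an orthonormal frame with timelike vector `n`, where they reduce to
polynomial identities in six field components. Such a frame exists at each point: the signature
provides some orthonormal frame, and a Lorentz transformation turns its timelike vector into `n`
(`exists_isAdaptedFrame`).

The analytic part differentiates the decomposition, which holds on a neighbourhood, with the
Leibniz rule. Differentiating `n_a n^a = -1`, `P_a n^a = 0` and `𝒯_ab n^b = 0` moves the
derivative onto `n` whenever an index is contracted with it; as the connection is metric and
torsion-free, the resulting terms assemble into the acceleration, expansion, shear and vorticity,
the Lie derivatives and the Cattaneo operator.
-/

noncomputable section

namespace Poynting

open scoped Topology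

/-! ### The Levi-Civita symbol and components in a frame -/

/-- The diagonal entries `-1, 1, 1, 1` of the Minkowski metric. -/
def minkSign (i : Fin 4) : ℝ := if i = 0 then -1 else 1

/-- The Levi-Civita symbol in four dimensions, written as the Vandermonde product of its indices
divided by its value `12` at `(0, 1, 2, 3)`. -/
def leviCivita (a b c d : Fin 4) : ℝ :=
  (((b : ℕ) : ℝ) - a) * ((c : ℕ) - a) * ((d : ℕ) - a) * ((c : ℕ) - b) * ((d : ℕ) - b)
    * ((d : ℕ) - c) / 12

/-- The components `L_a M^a_i` of a covector `L` in the frame whose vectors are the columns of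
`M`. -/
def pull (M : Matrix (Fin 4) (Fin 4) ℝ) (L : Fin 4 → ℝ) (i : Fin 4) : ℝ := ∑ a, L a * M a i

theorem pull_injective {M : Matrix (Fin 4) (Fin 4) ℝ} (hM : IsUnit M.det) :
    Function.Injective (pull M) := by
  intro L K h
  have : Matrix.vecMul L M = Matrix.vecMul K M := by
    funext i; exact congrFun h i
  have h2 := congrArg (fun v => Matrix.vecMul v M⁻¹) this
  simpa [Matrix.vecMul_vecMul, Matrix.mul_nonsing_inv _ hM] using h2

theorem pull_sub (M : Matrix (Fin 4) (Fin 4) ℝ) (L K : Fin 4 → ℝ) :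
    pull M (fun a => L a - K a) = fun i => pull M L i - pull M K i := by
  funext i; simp [pull, sub_mul, Finset.sum_sub_distrib]

theorem pull_add (M : Matrix (Fin 4) (Fin 4) ℝ) (L K : Fin 4 → ℝ) :
    pull M (fun a => L a + K a) = fun i => pull M L i + pull M K i := by
  funext i; simp [pull, add_mul, Finset.sum_add_distrib]

theorem pull_const_mul (M : Matrix (Fin 4) (Fin 4) ℝ) (c : ℝ) (L : Fin 4 → ℝ) :
    pull M (fun a => c * L a) = fun i => c * pull M L i := by
  funext i; simp [pull, Finset.mul_sum, mul_assoc]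

theorem pull_mul_const (M : Matrix (Fin 4) (Fin 4) ℝ) (c : ℝ) (L : Fin 4 → ℝ) :
    pull M (fun a => L a * c) = fun i => pull M L i * c := by
  funext i; simp only [pull, Finset.sum_mul]; exact Finset.sum_congr rfl fun _ _ => by ring

theorem pull_sum (M : Matrix (Fin 4) (Fin 4) ℝ) (L : Fin 4 → Fin 4 → ℝ) :
    pull M (fun a => ∑ c, L a c) = fun i => ∑ c, pull M (fun a => L a c) i := by
  funext i; simp only [pull, Finset.sum_mul]; exact Finset.sum_comm

theorem pull_comm (M : Matrix (Fin 4) (Fin 4) ℝ) (T : Fin 4 → Fin 4 → ℝ) (i k : Fin 4) :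
    pull M (fun a => pull M (fun b => T a b) k) i
      = pull M (fun b => pull M (fun a => T a b) i) k := by
  simp only [pull, Finset.sum_mul]
  rw [Finset.sum_comm]
  exact Finset.sum_congr rfl fun _ _ => Finset.sum_congr rfl fun _ _ => by ring

/-- The components of a covariant tensor of rank two in the frame of the columns of `M`. -/
def pull₂ (M : Matrix (Fin 4) (Fin 4) ℝ) (T : Fin 4 → Fin 4 → ℝ) (i k : Fin 4) : ℝ :=
  pull M (fun a => pull M (T a) k) i

/-- The components of a covariant tensor of rank three in the frame of the columns of `M`. -/
def pull₃ (M : Matrix (Fin 4) (Fin 4) ℝ) (T : Fin 4 → Fin 4 → Fin 4 → ℝ) (i k l : Fin 4) : ℝ :=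
  pull M (fun a => pull₂ M (T a) k l) i

/-- The components of a covariant tensor of rank four in the frame of the columns of `M`. -/
def pull₄ (M : Matrix (Fin 4) (Fin 4) ℝ) (T : Fin 4 → Fin 4 → Fin 4 → Fin 4 → ℝ)
    (i k l m : Fin 4) : ℝ :=
  pull M (fun a => pull₃ M (T a) k l m) i

theorem pull₂_injective {M : Matrix (Fin 4) (Fin 4) ℝ} (hM : IsUnit M.det) :
    Function.Injective (pull₂ M) := by
  intro T K h
  have h1 : ∀ k, (fun a => pull M (T a) k) = fun a => pull M (K a) k := fun k =>
    pull_injective hM (funext fun i => congrFun (congrFun h i) k)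
  funext a
  exact pull_injective hM (funext fun k => congrFun (h1 k) a)

theorem det_fin_four (N : Matrix (Fin 4) (Fin 4) ℝ) : N.det =
    N 0 0 * (N 1 1 * (N 2 2 * N 3 3 - N 2 3 * N 3 2) - N 1 2 * (N 2 1 * N 3 3 - N 2 3 * N 3 1)
      + N 1 3 * (N 2 1 * N 3 2 - N 2 2 * N 3 1))
    - N 0 1 * (N 1 0 * (N 2 2 * N 3 3 - N 2 3 * N 3 2) - N 1 2 * (N 2 0 * N 3 3 - N 2 3 * N 3 0)
      + N 1 3 * (N 2 0 * N 3 2 - N 2 2 * N 3 0))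
    + N 0 2 * (N 1 0 * (N 2 1 * N 3 3 - N 2 3 * N 3 1) - N 1 1 * (N 2 0 * N 3 3 - N 2 3 * N 3 0)
      + N 1 3 * (N 2 0 * N 3 1 - N 2 1 * N 3 0))
    - N 0 3 * (N 1 0 * (N 2 1 * N 3 2 - N 2 2 * N 3 1) - N 1 1 * (N 2 0 * N 3 2 - N 2 2 * N 3 0)
      + N 1 2 * (N 2 0 * N 3 1 - N 2 1 * N 3 0)) := by
  rw [Matrix.det_succ_row_zero, Fin.sum_univ_four]
  simp only [Matrix.det_fin_three, Matrix.submatrix_apply]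
  have e1 : ∀ k : Fin 4, k.succAbove 0 = if k = 0 then 1 else 0 := by decide
  have e2 : ∀ k : Fin 4, k.succAbove 1 = if k ≤ 1 then 2 else 1 := by decide
  have e3 : ∀ k : Fin 4, k.succAbove 2 = if k ≤ 2 then 3 else 2 := by decide
  have e4 : Fin.succ (2 : Fin 3) = 3 := rfl
  simp [e1, e2, e3, e4, Fin.le_def]
  ring

/-- Replacing the rows of the Vandermonde matrix of `0, 1, 2, 3` by the rows numbered `v` gives the
Vandermonde matrix of `v`; comparing determinants identifies the symbol with a determinant. -/
theorem det_submatrix_eq_leviCivita (M : Matrix (Fin 4) (Fin 4) ℝ) (v : Fin 4 → Fin 4) :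
    (M.transpose.submatrix v id).det = M.det * leviCivita (v 0) (v 1) (v 2) (v 3) := by
  have h1 : ∀ N : Matrix (Fin 4) (Fin 4) ℝ, N.submatrix v id =
      (1 : Matrix (Fin 4) (Fin 4) ℝ).submatrix v id * N := by
    intro N
    ext a b
    simp [Matrix.mul_apply, Matrix.one_apply]
  have h2 := congrArg Matrix.det (h1 (Matrix.vandermonde fun a : Fin 4 => ((a : ℕ) : ℝ)))
  rw [Matrix.det_mul] at h2
  generalize hP : ((1 : Matrix (Fin 4) (Fin 4) ℝ).submatrix v id).det = p at h2
  rw [h1, Matrix.det_mul, Matrix.det_transpose, leviCivita, hP]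
  simp [det_fin_four, Matrix.vandermonde_apply] at h2
  linear_combination (-M.det / 12) * h2

/-- The Levi-Civita symbol is a tensor density. -/
theorem pull₄_leviCivita (M : Matrix (Fin 4) (Fin 4) ℝ) (s : ℝ) (i k l m : Fin 4) :
    pull₄ M (fun a b c d => s * leviCivita a b c d) i k l m = s * M.det * leviCivita i k l m := by
  have h := det_submatrix_eq_leviCivita M ![i, k, l, m]
  rw [det_fin_four] at h
  change _ = M.det * leviCivita i k l m at h
  rw [mul_assoc, ← h]
  simp only [pull₄, pull₃, pull₂, pull, Fin.sum_univ_four, leviCivita]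
  change _ = s * (M 0 i * (M 1 k * (M 2 l * M 3 m - M 3 l * M 2 m)
    - M 2 k * (M 1 l * M 3 m - M 3 l * M 1 m) + M 3 k * (M 1 l * M 2 m - M 2 l * M 1 m))
    - M 1 i * (M 0 k * (M 2 l * M 3 m - M 3 l * M 2 m)
    - M 2 k * (M 0 l * M 3 m - M 3 l * M 0 m) + M 3 k * (M 0 l * M 2 m - M 2 l * M 0 m))
    + M 2 i * (M 0 k * (M 1 l * M 3 m - M 3 l * M 1 m)
    - M 1 k * (M 0 l * M 3 m - M 3 l * M 0 m) + M 3 k * (M 0 l * M 1 m - M 1 l * M 0 m))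
    - M 3 i * (M 0 k * (M 1 l * M 2 m - M 2 l * M 1 m)
    - M 1 k * (M 0 l * M 2 m - M 2 l * M 0 m) + M 2 k * (M 0 l * M 1 m - M 1 l * M 0 m)))
  norm_num
  ring

/-! ### Electrodynamics in a frame adapted to the observer -/

/-- The columns of `M` form a `g`-orthonormal frame at `y` whose timelike vector is the observer
`n`, and `σ = ±1` is its orientation with respect to `η`. The antisymmetry of `η` and of `F` is
recorded as well, so that the structure holds all the algebraic information on the fields at `y`. -/
structure IsAdaptedFrame (S : Fields) (y : Coord) (M : Matrix (Fin 4) (Fin 4) ℝ) (σ : ℝ) :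
    Prop where
  isUnit_det : IsUnit M.det
  gUp_eq : ∀ a b, S.gUp y a b = ∑ i, minkSign i * M a i * M b i
  pull_g : ∀ i k, pull₂ M (S.g y) i k = if i = k then minkSign i else 0
  n_eq : ∀ a, S.n y a = M a 0
  η_eq : ∀ a b c d, S.η y a b c d = S.η y 0 1 2 3 * leviCivita a b c d
  pull_η : ∀ i k l m, pull₄ M (S.η y) i k l m = σ * leviCivita i k l m
  sq_eq_one : σ ^ 2 = 1
  pull_F : ∀ i k, pull₂ M (S.F y) i k = - pull₂ M (S.F y) k i

namespace IsAdaptedFrame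

variable {S : Fields} {y : Coord} {M : Matrix (Fin 4) (Fin 4) ℝ} {σ : ℝ}

theorem sum_mul_n (fr : IsAdaptedFrame S y M σ) (X : Fin 4 → ℝ) :
    ∑ a, X a * S.n y a = pull M X 0 := by
  simp only [fr.n_eq, pull]

theorem raise_eq (fr : IsAdaptedFrame S y M σ) (L : Coord → Fin 4 → ℝ) (a : Fin 4) :
    S.raise L y a = ∑ i, minkSign i * M a i * pull M (L y) i := by
  simp only [Fields.raise, fr.gUp_eq, pull, Finset.mul_sum, Finset.sum_mul]
  rw [Finset.sum_comm]
  exact Finset.sum_congr rfl fun _ _ => Finset.sum_congr rfl fun _ _ => by ring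

theorem sum_mul_raise (fr : IsAdaptedFrame S y M σ) (X : Fin 4 → ℝ) (L : Coord → Fin 4 → ℝ) :
    ∑ a, X a * S.raise L y a = ∑ i, minkSign i * pull M X i * pull M (L y) i := by
  simp only [fr.raise_eq, pull, Finset.mul_sum, Finset.sum_mul]
  rw [Finset.sum_comm]
  refine Finset.sum_congr rfl fun _ _ => ?_
  rw [Finset.sum_comm]
  exact Finset.sum_congr rfl fun _ _ => Finset.sum_congr rfl fun _ _ => by ring

theorem raiseSecond_eq_raise (T : Coord → Fin 4 → Fin 4 → ℝ) (a b : Fin 4) :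
    S.raiseSecond T y a b = S.raise (fun z => T z a) y b := rfl

theorem raiseBoth_eq_raise (T : Coord → Fin 4 → Fin 4 → ℝ) (a b : Fin 4) :
    S.raiseBoth T y a b = S.raise (fun z c => S.raise (fun w => T w c) z b) y a := by
  simp only [Fields.raiseBoth, Fields.raise, Finset.mul_sum, mul_assoc]

theorem sum_mul_raiseBoth (fr : IsAdaptedFrame S y M σ) (X : Fin 4 → Fin 4 → ℝ)
    (T : Coord → Fin 4 → Fin 4 → ℝ) :
    ∑ a, ∑ b, X a b * S.raiseBoth T y a b =
      ∑ i, ∑ k, minkSign i * minkSign k * pull₂ M X i k * pull₂ M (T y) i k := by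
  simp only [raiseBoth_eq_raise]
  rw [Finset.sum_comm]
  simp only [fr.sum_mul_raise, fr.raise_eq (fun w => T w _)]
  rw [Finset.sum_comm]
  refine Finset.sum_congr rfl fun i _ => ?_
  simp only [pull_sum, pull_const_mul, pull₂, Finset.mul_sum]
  rw [Finset.sum_comm]
  refine Finset.sum_congr rfl fun k _ => ?_
  rw [pull_comm M X i k]
  conv_rhs => rw [pull, Finset.mul_sum, Finset.sum_mul]
  exact Finset.sum_congr rfl fun b _ => by ring

theorem pull_nDown (fr : IsAdaptedFrame S y M σ) (i : Fin 4) :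
    pull M (S.nDown y) i = if i = 0 then -1 else 0 := by
  have h := fr.pull_g i 0
  have : S.nDown y = fun a => pull M (S.g y a) 0 := by
    funext a; rw [← fr.sum_mul_n]; rfl
  rw [this]
  exact h.trans (by fin_cases i <;> simp [minkSign])

theorem pull_h (fr : IsAdaptedFrame S y M σ) (i k : Fin 4) :
    pull₂ M (S.h y) i k = if i = k then (if i = 0 then 0 else 1) else 0 := by
  have : S.h y = fun a b => S.g y a b + S.nDown y a * S.nDown y b := rfl
  simp only [this, pull₂, pull_add, pull_const_mul, pull_mul_const]
  rw [fr.pull_nDown, fr.pull_nDown]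
  have h := fr.pull_g i k
  simp only [pull₂] at h
  rw [h]
  fin_cases i <;> fin_cases k <;> simp [minkSign]

theorem pull_E (fr : IsAdaptedFrame S y M σ) (i : Fin 4) :
    pull M (S.E y) i = pull₂ M (S.F y) i 0 := by
  have : S.E y = fun a => pull M (S.F y a) 0 := by
    funext a; rw [← fr.sum_mul_n]; rfl
  rw [this]; rfl

theorem pull_dual (fr : IsAdaptedFrame S y M σ) (W : Coord → Fin 4 → Fin 4 → ℝ) (i k : Fin 4) :
    pull₂ M (fun a b => (1 / 2) * ∑ c, ∑ d, S.η y a b c d * S.raiseBoth W y c d) i k =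
      (1 / 2) * ∑ l, ∑ m, minkSign l * minkSign m * (σ * leviCivita i k l m) *
        pull₂ M (W y) l m := by
  simp only [fr.sum_mul_raiseBoth, ← fr.pull_η]
  rw [pull₂]
  simp only [pull_sum, pull_const_mul, pull_mul_const]
  rfl

theorem pull_FDual (fr : IsAdaptedFrame S y M σ) (i k : Fin 4) :
    pull₂ M (S.FDual y) i k =
      (1 / 2) * ∑ l, ∑ m, minkSign l * minkSign m * (σ * leviCivita i k l m) *
        pull₂ M (S.F y) l m := fr.pull_dual S.F i k

theorem pull_B (fr : IsAdaptedFrame S y M σ) (i : Fin 4) :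
    pull M (S.B y) i = pull₂ M (S.FDual y) i 0 := by
  have : S.B y = fun a => pull M (S.FDual y a) 0 := by
    funext a; rw [← fr.sum_mul_n]; rfl
  rw [this]; rfl

theorem pull_eps (fr : IsAdaptedFrame S y M σ) (i k l : Fin 4) :
    pull₃ M (S.eps y) i k l = σ * leviCivita 0 i k l := by
  rw [← fr.pull_η]
  have : S.eps y = fun a b c => pull M (fun d => S.η y d a b c) 0 := by
    funext a b c
    rw [← fr.sum_mul_n]
    exact Finset.sum_congr rfl fun _ _ => mul_comm _ _
  rw [this]
  simp only [pull₄, pull₃, pull₂]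
  simp only [pull_comm M (fun c d => S.η y d _ _ c),
    pull_comm M (fun b d => pull M (fun c => S.η y d _ b c) _)]
  rw [pull_comm]

theorem sum_mul_raise_mul_raise (fr : IsAdaptedFrame S y M σ) (X : Fin 4 → Fin 4 → ℝ)
    (L K : Coord → Fin 4 → ℝ) :
    ∑ b, ∑ c, X b c * S.raise L y b * S.raise K y c = ∑ k, ∑ l, minkSign k * minkSign l *
      pull₂ M X k l * pull M (L y) k * pull M (K y) l := by
  simp only [fr.sum_mul_raise _ K, pull_mul_const]
  rw [Finset.sum_comm, Finset.sum_comm (γ := Fin 4) (f := fun k l => minkSign k * _ * _ * _ * _)]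
  refine Finset.sum_congr rfl fun l _ => ?_
  have h : ∑ b, minkSign l * (pull M (X b) l * S.raise L y b) * pull M (K y) l =
      minkSign l * pull M (K y) l * ∑ b, pull M (X b) l * S.raise L y b := by
    rw [Finset.mul_sum]; exact Finset.sum_congr rfl fun _ _ => by ring
  rw [h, fr.sum_mul_raise, Finset.mul_sum]
  exact Finset.sum_congr rfl fun _ _ => by rw [pull₂]; ring

theorem pull_eps_contract (fr : IsAdaptedFrame S y M σ) (L K : Coord → Fin 4 → ℝ) (i : Fin 4) :
    pull M (fun a => ∑ b, ∑ c, S.eps y a b c * S.raise L y b * S.raise K y c) i =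
      ∑ k, ∑ l, minkSign k * minkSign l * (σ * leviCivita 0 i k l) *
        pull M (L y) k * pull M (K y) l := by
  simp only [← fr.pull_eps, fr.sum_mul_raise_mul_raise]
  simp only [pull_sum, pull_const_mul, pull_mul_const]
  rfl

theorem pull_P (fr : IsAdaptedFrame S y M σ) (i : Fin 4) :
    pull M (S.P y) i = ∑ k, ∑ l, minkSign k * minkSign l * (σ * leviCivita 0 i k l) *
      pull M (S.B y) k * pull M (S.E y) l :=
  fr.pull_eps_contract S.B S.E i

theorem pull_eps_contract_one (fr : IsAdaptedFrame S y M σ) (L : Coord → Fin 4 → ℝ) (i k : Fin 4) :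
    pull₂ M (fun a b => ∑ c, S.eps y a b c * S.raise L y c) i k =
      ∑ l, minkSign l * (σ * leviCivita 0 i k l) * pull M (L y) l := by
  simp only [← fr.pull_eps]
  simp only [fr.sum_mul_raise]
  rw [pull₂]
  simp only [pull_sum, pull_const_mul, pull_mul_const]
  rfl

theorem U_eq (fr : IsAdaptedFrame S y M σ) : S.U y =
    (1 / 2) * ((∑ i, minkSign i * pull M (S.E y) i * pull M (S.E y) i)
      + ∑ i, minkSign i * pull M (S.B y) i * pull M (S.B y) i) := by
  rw [Fields.U, fr.sum_mul_raise, fr.sum_mul_raise]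

theorem pull_stress (i k : Fin 4) :
    pull₂ M (S.stress y) i k = S.U y * pull₂ M (S.h y) i k
      - pull M (S.E y) i * pull M (S.E y) k - pull M (S.B y) i * pull M (S.B y) k := by
  have : S.stress y = fun a b =>
    S.U y * S.h y a b - S.E y a * S.E y b - S.B y a * S.B y b := rfl
  simp only [this, pull₂, pull_sub, pull_const_mul, pull_mul_const]

theorem pull_energyMomentum (fr : IsAdaptedFrame S y M σ) (i k : Fin 4) :
    pull₂ M (S.energyMomentum y) i k =
      (∑ l, minkSign l * pull₂ M (S.F y) i l * pull₂ M (S.F y) k l)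
      - (1 / 4) * (if i = k then minkSign i else 0) *
        ∑ l, ∑ m, minkSign l * minkSign m * pull₂ M (S.F y) l m * pull₂ M (S.F y) l m := by
  rw [← fr.pull_g]
  have : S.energyMomentum y = fun a b => (∑ d, S.F y a d * S.raiseSecond S.F y b d)
    - (1 / 4) * S.g y a b * ∑ c, ∑ d, S.F y c d * S.raiseBoth S.F y c d := rfl
  simp only [this, raiseSecond_eq_raise, fr.sum_mul_raise, fr.sum_mul_raiseBoth]
  simp only [pull₂, pull_sub, pull_sum, pull_const_mul, pull_mul_const]

/-- In an adapted frame the Faraday tensor is the usual matrix of three electric and three magnetic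
components. The sign of the magnetic part depends on the orientation. -/
theorem exists_field_components (fr : IsAdaptedFrame S y M σ) :
    ∃ e₁ e₂ e₃ b₁ b₂ b₃ : ℝ,
      pull₂ M (S.F y) =
        ![![0, -e₁, -e₂, -e₃], ![e₁, 0, b₃, -b₂], ![e₂, -b₃, 0, b₁], ![e₃, b₂, -b₁, 0]] ∧
      (∀ i, pull M (S.E y) i = ![0, e₁, e₂, e₃] i) ∧
      ∀ i, pull M (S.B y) i = -σ * ![0, b₁, b₂, b₃] i := by
  have hF : pull₂ M (S.F y) =
      ![![0, -pull₂ M (S.F y) 1 0, -pull₂ M (S.F y) 2 0, -pull₂ M (S.F y) 3 0],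
        ![pull₂ M (S.F y) 1 0, 0, pull₂ M (S.F y) 1 2, -pull₂ M (S.F y) 3 1],
        ![pull₂ M (S.F y) 2 0, -pull₂ M (S.F y) 1 2, 0, pull₂ M (S.F y) 2 3],
        ![pull₂ M (S.F y) 3 0, pull₂ M (S.F y) 3 1, -pull₂ M (S.F y) 2 3, 0]] := by
    funext i k
    have h := fr.pull_F i k
    have h' := fr.pull_F k i
    fin_cases i <;> fin_cases k <;> simp at h h' ⊢ <;> linarith
  refine ⟨_, _, _, _, _, _, hF, fun i => ?_, fun i => ?_⟩
  · rw [fr.pull_E]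
    generalize pull₂ M (S.F y) = f at hF
    rw [hF]
    fin_cases i <;> rfl
  · rw [fr.pull_B, fr.pull_FDual]
    generalize pull₂ M (S.F y) = f at hF
    rw [hF]
    fin_cases i <;> simp [Fin.sum_univ_four, leviCivita, minkSign] <;> ring

/-- The energy-momentum tensor consists of the energy density, the Poynting vector and the Maxwell
stress tensor. -/
theorem energyMomentum_eq (fr : IsAdaptedFrame S y M σ) (a b : Fin 4) :
    S.energyMomentum y a b = S.U y * S.nDown y a * S.nDown y b + S.nDown y a * S.P y b
      + S.P y a * S.nDown y b + S.stress y a b := by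
  have key : pull₂ M (S.energyMomentum y) = pull₂ M fun a b => S.U y * S.nDown y a * S.nDown y b
      + S.nDown y a * S.P y b + S.P y a * S.nDown y b + S.stress y a b := by
    funext i k
    have e : ∀ i k, pull₂ M (fun a b => S.U y * S.nDown y a * S.nDown y b
      + S.nDown y a * S.P y b + S.P y a * S.nDown y b + S.stress y a b) i k =
        S.U y * pull M (S.nDown y) i * pull M (S.nDown y) k
        + pull M (S.nDown y) i * pull M (S.P y) k
      + pull M (S.P y) i * pull M (S.nDown y) k + pull₂ M (S.stress y) i k := by
      intro i k
      simp only [pull₂, pull_add, pull_const_mul, pull_mul_const]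
    obtain ⟨e₁, e₂, e₃, b₁, b₂, b₃, hF, hE, hB⟩ := fr.exists_field_components
    have hP : ∀ i, pull M (S.P y) i =
        ![0, e₂ * b₃ - e₃ * b₂, e₃ * b₁ - e₁ * b₃, e₁ * b₂ - e₂ * b₁] i := by
      intro i
      simp only [fr.pull_P, hE, hB]
      fin_cases i <;> simp [Fin.sum_univ_four, leviCivita, minkSign]
      · linear_combination (e₂ * b₃ - e₃ * b₂) * fr.sq_eq_one
      · linear_combination (e₃ * b₁ - e₁ * b₃) * fr.sq_eq_one
      · linear_combination (e₁ * b₂ - e₂ * b₁) * fr.sq_eq_one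
    have hBB : ∀ i k, pull M (S.B y) i * pull M (S.B y) k
        = ![0, b₁, b₂, b₃] i * ![0, b₁, b₂, b₃] k := by
      intro i k
      rw [hB, hB]
      linear_combination (![0, b₁, b₂, b₃] i * ![0, b₁, b₂, b₃] k) * fr.sq_eq_one
    have hU : S.U y = (1 / 2) * (e₁ ^ 2 + e₂ ^ 2 + e₃ ^ 2 + b₁ ^ 2 + b₂ ^ 2 + b₃ ^ 2) := by
      rw [fr.U_eq]
      simp only [mul_assoc (minkSign _), hE, hBB]
      simp [Fin.sum_univ_four, minkSign]
      ring
    rw [e, fr.pull_energyMomentum, pull_stress, fr.pull_h]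
    simp only [hE, hBB, hP, hU, hF, fr.pull_nDown]
    fin_cases i <;> fin_cases k <;> simp [Fin.sum_univ_four, minkSign] <;> ring
  exact congrFun (congrFun (pull₂_injective fr.isUnit_det key) a) b

/-- The splitting of the Faraday tensor into its electric and magnetic parts. -/
theorem F_eq (fr : IsAdaptedFrame S y M σ) (a b : Fin 4) :
    S.F y a b = S.nDown y a * S.E y b - S.E y a * S.nDown y b
      - ∑ c, S.eps y a b c * S.raise S.B y c := by
  have key : pull₂ M (S.F y) = pull₂ M fun a b => S.nDown y a * S.E y b - S.E y a * S.nDown y b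
      - ∑ c, S.eps y a b c * S.raise S.B y c := by
    funext i k
    have e : pull₂ M (fun a b => S.nDown y a * S.E y b - S.E y a * S.nDown y b
      - ∑ c, S.eps y a b c * S.raise S.B y c) i k =
        pull M (S.nDown y) i * pull M (S.E y) k - pull M (S.E y) i * pull M (S.nDown y) k
        - pull₂ M (fun a b => ∑ c, S.eps y a b c * S.raise S.B y c) i k := by
      simp only [pull₂, pull_sub, pull_const_mul, pull_mul_const]
    obtain ⟨e₁, e₂, e₃, b₁, b₂, b₃, hF, hE, hB'⟩ := fr.exists_field_components
    -- `B` changes sign with the orientation, so that `σ B` does not depend on it.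
    have hB : ∀ i, σ * pull M (S.B y) i = -![0, b₁, b₂, b₃] i := by
      intro i
      rw [hB']
      linear_combination (-![0, b₁, b₂, b₃] i) * fr.sq_eq_one
    have r : ∀ l, minkSign l * (σ * leviCivita 0 i k l) * pull M (S.B y) l =
        minkSign l * leviCivita 0 i k l * (σ * pull M (S.B y) l) := fun l => by ring
    rw [e, fr.pull_eps_contract_one]
    simp only [r, hE, hB, hF, fr.pull_nDown]
    fin_cases i <;> fin_cases k <;> simp [Fin.sum_univ_four, minkSign, leviCivita] <;> norm_num
  exact congrFun (congrFun (pull₂_injective fr.isUnit_det key) a) b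

/-- A spatial antisymmetric tensor of rank two is the spatial dual of its spatial dual. -/
theorem eq_eps_dual (fr : IsAdaptedFrame S y M σ) (W : Coord → Fin 4 → Fin 4 → ℝ)
    (hW : ∀ a b, W y a b = - W y b a) (hn : ∀ a, ∑ b, W y a b * S.n y b = 0) (a b : Fin 4) :
    W y a b = ∑ c, S.eps y a b c *
      S.raise (fun z a => (1 / 2) * ∑ b, ∑ c, S.eps z a b c * S.raiseBoth W z b c) y c := by
  set v : Coord → Fin 4 → ℝ :=
    fun z a => (1 / 2) * ∑ b, ∑ c, S.eps z a b c * S.raiseBoth W z b c with hv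
  have key : pull₂ M (W y) = pull₂ M fun a b => ∑ c, S.eps y a b c * S.raise v y c := by
    funext i k
    have hw : ∀ i k, pull₂ M (W y) i k = - pull₂ M (W y) k i := by
      intro i k
      have h : pull₂ M (W y) i k = pull M (fun a => pull M (fun b => -W y b a) k) i := by
        simp only [← hW]; rfl
      rw [h, pull_comm]
      simp [pull₂, pull]
    have hw0 : ∀ i, pull₂ M (W y) i 0 = 0 := by
      intro i
      have : (fun a => pull M (W y a) 0) = fun a => 0 := by
        funext a; rw [← fr.sum_mul_n, hn]
      rw [pull₂, this]; simp [pull]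
    have hvi : ∀ i, σ * pull M (v y) i = (1 / 2) * ∑ l, ∑ m, minkSign l * minkSign m *
        leviCivita 0 i l m * pull₂ M (W y) l m := by
      intro i
      simp only [hv, fr.sum_mul_raiseBoth]
      simp only [pull_sum, pull_const_mul, pull_mul_const]
      have r : ∀ l m, pull M (fun a => pull₂ M (S.eps y a) l m) i = σ * leviCivita 0 i l m :=
        fun l m => fr.pull_eps i l m
      simp only [r, Finset.mul_sum]
      refine Finset.sum_congr rfl fun l _ => Finset.sum_congr rfl fun m _ => ?_
      linear_combination (1 / 2 * (minkSign l * minkSign m * leviCivita 0 i l m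
        * pull₂ M (W y) l m)) * fr.sq_eq_one
    have r : ∀ l, minkSign l * (σ * leviCivita 0 i k l) * pull M (v y) l =
        minkSign l * leviCivita 0 i k l * (σ * pull M (v y) l) := fun l => by ring
    rw [fr.pull_eps_contract_one]
    simp only [r, hvi]
    generalize pull₂ M (W y) = w at *
    have h00 := hw 0 0
    have h11 := hw 1 1
    have h22 := hw 2 2
    have h33 := hw 3 3
    have h10 := hw 1 0
    have h20 := hw 2 0
    have h30 := hw 3 0
    have h12 := hw 1 2
    have h13 := hw 1 3
    have h23 := hw 2 3
    have a1 := hw0 1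
    have a2 := hw0 2
    have a3 := hw0 3
    fin_cases i <;> fin_cases k <;> simp [Fin.sum_univ_four, minkSign, leviCivita] <;>
      norm_num <;> linarith
  exact congrFun (congrFun (pull₂_injective fr.isUnit_det key) a) b

end IsAdaptedFrame

/-! ### Partial and covariant derivatives -/

section PartialDerivatives

variable {f f' : Coord → ℝ} {y : Coord}

theorem pd_congr (h : f =ᶠ[𝓝 y] f') (a : Fin 4) : pd f y a = pd f' y a := by
  rw [pd, pd, h.fderiv_eq]

theorem pd_const (c : ℝ) (a : Fin 4) : pd (fun _ => c) y a = 0 := by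
  simp [pd]

theorem pd_add (hf : DifferentiableAt ℝ f y) (hf' : DifferentiableAt ℝ f' y) (a : Fin 4) :
    pd (fun z => f z + f' z) y a = pd f y a + pd f' y a := by
  simp [pd, fderiv_fun_add hf hf']

theorem pd_sub (hf : DifferentiableAt ℝ f y) (hf' : DifferentiableAt ℝ f' y) (a : Fin 4) :
    pd (fun z => f z - f' z) y a = pd f y a - pd f' y a := by
  simp [pd, fderiv_fun_sub hf hf']

theorem pd_mul (hf : DifferentiableAt ℝ f y) (hf' : DifferentiableAt ℝ f' y) (a : Fin 4) :
    pd (fun z => f z * f' z) y a = pd f y a * f' y + f y * pd f' y a := by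
  simp [pd, fderiv_fun_mul hf hf']; ring

theorem pd_sum {F : Fin 4 → Coord → ℝ} (hF : ∀ i, DifferentiableAt ℝ (F i) y) (a : Fin 4) :
    pd (fun z => ∑ i, F i z) y a = ∑ i, pd (F i) y a := by
  simp [pd, fderiv_fun_sum fun i _ => hF i]

theorem pd_sum_mul {F G : Fin 4 → Coord → ℝ} (hF : ∀ i, DifferentiableAt ℝ (F i) y)
    (hG : ∀ i, DifferentiableAt ℝ (G i) y) (a : Fin 4) :
    pd (fun z => ∑ i, F i z * G i z) y a = ∑ i, (pd (F i) y a * G i y + F i y * pd (G i) y a) := by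
  rw [pd_sum (F := fun i z => F i z * G i z) fun i => (hF i).fun_mul (hG i)]
  exact Finset.sum_congr rfl fun i _ => pd_mul (hF i) (hG i) a

end PartialDerivatives

namespace Fields

variable {S : Fields} {y : Coord}

theorem nablaVec_congr {X X' : Coord → Fin 4 → ℝ} (h : ∀ᶠ z in 𝓝 y, X z = X' z) (a b : Fin 4) :
    S.nablaVec X y a b = S.nablaVec X' y a b := by
  have : (fun z => X z b) =ᶠ[𝓝 y] fun z => X' z b := h.mono fun z hz => by simp only [hz]
  simp only [nablaVec, pd_congr this, h.self_of_nhds]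

theorem nablaCov_congr {X X' : Coord → Fin 4 → ℝ} (h : ∀ᶠ z in 𝓝 y, X z = X' z) (a b : Fin 4) :
    S.nablaCov X y a b = S.nablaCov X' y a b := by
  have : (fun z => X z b) =ᶠ[𝓝 y] fun z => X' z b := h.mono fun z hz => by simp only [hz]
  simp only [nablaCov, pd_congr this, h.self_of_nhds]

theorem nablaMixed_congr {T T' : Coord → Fin 4 → Fin 4 → ℝ} (h : ∀ᶠ z in 𝓝 y, T z = T' z)
    (c b a : Fin 4) : S.nablaMixed T y c b a = S.nablaMixed T' y c b a := by
  have : (fun z => T z b a) =ᶠ[𝓝 y] fun z => T' z b a := h.mono fun z hz => by simp only [hz]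
  simp only [nablaMixed, pd_congr this, h.self_of_nhds]

theorem nablaVec_zero (a b : Fin 4) : S.nablaVec (fun _ _ => 0) y a b = 0 := by
  simp [nablaVec, pd_const]

theorem nablaCov_zero (a b : Fin 4) : S.nablaCov (fun _ _ => 0) y a b = 0 := by
  simp [nablaCov, pd_const]

theorem nablaVec_add {X X' : Coord → Fin 4 → ℝ} (hX : ∀ a, DifferentiableAt ℝ (fun z => X z a) y)
    (hX' : ∀ a, DifferentiableAt ℝ (fun z => X' z a) y) (a b : Fin 4) :
    S.nablaVec (fun z b => X z b + X' z b) y a b = S.nablaVec X y a b + S.nablaVec X' y a b := by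
  simp only [nablaVec, pd_add (hX b) (hX' b), mul_add, Finset.sum_add_distrib]
  ring

theorem nablaVec_sub {X X' : Coord → Fin 4 → ℝ} (hX : ∀ a, DifferentiableAt ℝ (fun z => X z a) y)
    (hX' : ∀ a, DifferentiableAt ℝ (fun z => X' z a) y) (a b : Fin 4) :
    S.nablaVec (fun z b => X z b - X' z b) y a b = S.nablaVec X y a b - S.nablaVec X' y a b := by
  simp only [nablaVec, pd_sub (hX b) (hX' b), mul_sub, Finset.sum_sub_distrib]
  ring

theorem nablaVec_smul {f : Coord → ℝ} {X : Coord → Fin 4 → ℝ} (hf : DifferentiableAt ℝ f y)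
    (hX : ∀ a, DifferentiableAt ℝ (fun z => X z a) y) (a b : Fin 4) :
    S.nablaVec (fun z b => f z * X z b) y a b = pd f y a * X y b + f y * S.nablaVec X y a b := by
  simp only [nablaVec, pd_mul hf (hX b), mul_add, Finset.mul_sum]
  rw [add_assoc]
  congr 2
  exact Finset.sum_congr rfl fun _ _ => by ring

theorem nablaMixed_add {T T' : Coord → Fin 4 → Fin 4 → ℝ}
    (hT : ∀ b a, DifferentiableAt ℝ (fun z => T z b a) y)
    (hT' : ∀ b a, DifferentiableAt ℝ (fun z => T' z b a) y) (c b a : Fin 4) :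
    S.nablaMixed (fun z b a => T z b a + T' z b a) y c b a =
      S.nablaMixed T y c b a + S.nablaMixed T' y c b a := by
  simp only [nablaMixed, pd_add (hT b a) (hT' b a), mul_add, Finset.sum_add_distrib]
  ring

theorem nablaMixed_mul {X L : Coord → Fin 4 → ℝ} (hX : ∀ a, DifferentiableAt ℝ (fun z => X z a) y)
    (hL : ∀ a, DifferentiableAt ℝ (fun z => L z a) y) (c b a : Fin 4) :
    S.nablaMixed (fun z b a => X z b * L z a) y c b a =
      S.nablaVec X y c b * L y a + X y b * S.nablaCov L y c a := by
  simp only [nablaMixed, nablaVec, nablaCov, pd_mul (hX b) (hL a), add_mul, mul_sub,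
    Finset.mul_sum, Finset.sum_mul]
  have h1 : ∀ d, S.christoffel y b c d * (X y d * L y a) =
    S.christoffel y b c d * X y d * L y a := fun d => by ring
  have h2 : ∀ d, S.christoffel y d c a * (X y b * L y d) =
    X y b * (S.christoffel y d c a * L y d) := fun d => by ring
  simp only [h1, h2]
  ring

/-- The connection terms of the two covariant derivatives cancel. -/
theorem pd_pairing {L X : Coord → Fin 4 → ℝ} (hL : ∀ a, DifferentiableAt ℝ (fun z => L z a) y)
    (hX : ∀ a, DifferentiableAt ℝ (fun z => X z a) y) (a : Fin 4) :
    pd (fun z => ∑ b, L z b * X z b) y a =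
      ∑ b, (S.nablaCov L y a b * X y b + L y b * S.nablaVec X y a b) := by
  rw [pd_sum_mul hL hX]
  simp only [nablaCov, nablaVec, sub_mul, mul_add,
    Finset.mul_sum, Finset.sum_mul, Finset.sum_add_distrib, Finset.sum_sub_distrib]
  rw [Finset.sum_comm (f := fun b c => S.christoffel y c a b * L y c * X y b)]
  have h : ∀ b c, L y b * (S.christoffel y b a c * X y c) =
    S.christoffel y b a c * L y b * X y c := fun b c => by ring
  simp only [h]
  ring

theorem nablaVec_contract {T : Coord → Fin 4 → Fin 4 → ℝ} {X : Coord → Fin 4 → ℝ}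
    (hT : ∀ b a, DifferentiableAt ℝ (fun z => T z b a) y)
    (hX : ∀ a, DifferentiableAt ℝ (fun z => X z a) y) (c b : Fin 4) :
    S.nablaVec (fun z b => ∑ a, T z b a * X z a) y c b =
      ∑ a, (S.nablaMixed T y c b a * X y a + T y b a * S.nablaVec X y c a) := by
  rw [nablaVec, pd_sum_mul (hT b) hX]
  simp only [nablaMixed, nablaVec, sub_mul, add_mul, mul_add,
    Finset.mul_sum, Finset.sum_mul, Finset.sum_add_distrib, Finset.sum_sub_distrib]
  rw [Finset.sum_comm (f := fun a d => S.christoffel y d c a * T y b d * X y a),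
    Finset.sum_comm (f := fun a d => S.christoffel y b c d * T y d a * X y a)]
  have h : ∀ d a, T y b d * (S.christoffel y d c a * X y a) =
    S.christoffel y d c a * T y b d * X y a := fun b c => by ring
  simp only [h, mul_assoc]
  ring

theorem nablaCov_contract {T : Coord → Fin 4 → Fin 4 → ℝ} {L : Coord → Fin 4 → ℝ}
    (hT : ∀ b a, DifferentiableAt ℝ (fun z => T z b a) y)
    (hL : ∀ a, DifferentiableAt ℝ (fun z => L z a) y) (c a : Fin 4) :
    S.nablaCov (fun z a => ∑ b, L z b * T z b a) y c a =
      ∑ b, (S.nablaCov L y c b * T y b a + L y b * S.nablaMixed T y c b a) := by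
  rw [nablaCov, pd_sum_mul hL fun b => hT b a]
  simp only [nablaMixed, nablaCov, sub_mul, mul_sub, mul_add,
    Finset.mul_sum, Finset.sum_mul, Finset.sum_add_distrib, Finset.sum_sub_distrib]
  rw [Finset.sum_comm (f := fun b d => S.christoffel y d c b * L y d * T y b a),
    Finset.sum_comm (f := fun b d => L y b * (S.christoffel y d c a * T y b d))]
  have h : ∀ d b, L y d * (S.christoffel y d c b * T y b a) =
    S.christoffel y d c b * L y d * T y b a := fun b c => by ring
  have h' : ∀ d b, L y b * (S.christoffel y d c a * T y b d) =
    S.christoffel y d c a * (L y b * T y b d) := fun b c => by ring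
  simp only [h, h']
  ring

theorem christoffel_symm (hg : ∀ᶠ z in 𝓝 y, ∀ a b, S.g z a b = S.g z b a) (c a b : Fin 4) :
    S.christoffel y c a b = S.christoffel y c b a := by
  have h : ∀ a b c, pd (fun z => S.g z a b) y c = pd (fun z => S.g z b a) y c := fun a b c =>
    pd_congr (hg.mono fun z hz => hz a b) c
  simp only [christoffel, h a b]
  congr 1
  exact Finset.sum_congr rfl fun _ _ => by ring

theorem sum_g_mul_christoffel (hg : IsUnit (S.g y).det) (d a b : Fin 4) :
    ∑ c, S.g y d c * S.christoffel y c a b = (1 / 2) *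
      (pd (fun z => S.g z d b) y a + pd (fun z => S.g z d a) y b
        - pd (fun z => S.g z a b) y d) := by
  set v : Fin 4 → ℝ := fun d =>
    pd (fun z => S.g z d b) y a + pd (fun z => S.g z d a) y b - pd (fun z => S.g z a b) y d
  have h : (S.g y).mulVec ((S.g y)⁻¹.mulVec v) = v := by
    rw [Matrix.mulVec_mulVec, Matrix.mul_nonsing_inv _ hg, Matrix.one_mulVec]
  have h2 := congrFun h d
  change _ = (1 / 2) * v d
  rw [← h2]
  simp only [christoffel, Matrix.mulVec, dotProduct, Finset.mul_sum]
  exact Finset.sum_congr rfl fun _ _ => Finset.sum_congr rfl fun _ _ => by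
    simp only [gUp, v]; ring

/-- The connection is compatible with the metric: lowering an index commutes with `∇`. -/
theorem nablaCov_lower (hg : IsUnit (S.g y).det)
    (hsymm : ∀ᶠ z in 𝓝 y, ∀ a b, S.g z a b = S.g z b a)
    (hgd : ∀ a b, DifferentiableAt ℝ (fun z => S.g z a b) y) {X : Coord → Fin 4 → ℝ}
    (hX : ∀ a, DifferentiableAt ℝ (fun z => X z a) y) (a b : Fin 4) :
    S.nablaCov (S.lower X) y a b = ∑ c, S.g y b c * S.nablaVec X y a c := by
  have h : ∀ a b c, pd (fun z => S.g z a b) y c = pd (fun z => S.g z b a) y c := fun a b c =>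
    pd_congr (hsymm.mono fun z hz => hz a b) c
  have e1 : ∑ c, S.christoffel y c a b * S.lower X y c =
      ∑ d, (∑ c, S.g y d c * S.christoffel y c a b) * X y d := by
    simp only [lower, Finset.mul_sum, Finset.sum_mul]
    rw [Finset.sum_comm]
    refine Finset.sum_congr rfl fun d _ => Finset.sum_congr rfl fun c _ => ?_
    rw [hsymm.self_of_nhds c d]; ring
  have e2 : ∑ c, S.g y b c * S.nablaVec X y a c = (∑ c, S.g y b c * pd (fun z => X z c) y a) +
      ∑ d, (∑ c, S.g y b c * S.christoffel y c a d) * X y d := by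
    simp only [nablaVec, mul_add, Finset.mul_sum, Finset.sum_mul, Finset.sum_add_distrib]
    rw [Finset.sum_comm (f := fun d c => S.g y b c * S.christoffel y c a d * X y d)]
    simp only [mul_assoc]
  have e3 : pd (fun z => S.lower X z b) y a =
      ∑ c, (pd (fun z => S.g z b c) y a * X y c + S.g y b c * pd (fun z => X z c) y a) :=
    pd_sum_mul (hgd b) hX a
  rw [nablaCov, e1, e2, e3, Finset.sum_add_distrib]
  simp only [sum_g_mul_christoffel hg]
  rw [add_comm, add_sub_assoc, ← Finset.sum_sub_distrib]
  congr 1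
  refine Finset.sum_congr rfl fun d _ => ?_
  rw [h d b a, h d a b, h a b d]
  ring

/-- The connection is torsion-free: in the Lie derivative, partial derivatives may be replaced by
covariant ones. -/
theorem lieCov_eq (hsymm : ∀ᶠ z in 𝓝 y, ∀ a b, S.g z a b = S.g z b a) (L : Coord → Fin 4 → ℝ)
    (a : Fin 4) : S.lieCov L y a =
      ∑ b, (S.n y b * S.nablaCov L y b a + L y b * S.nablaVec S.n y a b) := by
  simp only [lieCov, nablaCov, nablaVec, mul_sub, mul_add, Finset.mul_sum,
    Finset.sum_add_distrib, Finset.sum_sub_distrib]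
  rw [Finset.sum_comm (f := fun b c => S.n y b * (S.christoffel y c b a * L y c))]
  have h : ∀ b c, S.n y b * (S.christoffel y c b a * L y c) =
      L y c * (S.christoffel y c a b * S.n y b) := fun b c => by
    rw [christoffel_symm hsymm c b a]; ring
  simp only [h]
  ring

end Fields

/-! ### Raising, lowering and projecting -/

namespace IsAdaptedFrame

variable {S : Fields} {y : Coord} {M : Matrix (Fin 4) (Fin 4) ℝ} {σ : ℝ}

theorem g_symm (fr : IsAdaptedFrame S y M σ) (a b : Fin 4) : S.g y a b = S.g y b a := by
  have key : pull₂ M (S.g y) = pull₂ M fun a b => S.g y b a := by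
    funext i k
    have h : pull₂ M (fun a b => S.g y b a) i k = pull₂ M (S.g y) k i := pull_comm _ _ _ _
    rw [h, fr.pull_g, fr.pull_g]
    by_cases hik : i = k
    · simp [hik]
    · simp [hik, Ne.symm hik]
  exact congrFun (congrFun (pull₂_injective fr.isUnit_det key) a) b

theorem gUp_symm (fr : IsAdaptedFrame S y M σ) (a b : Fin 4) : S.gUp y a b = S.gUp y b a := by
  rw [fr.gUp_eq, fr.gUp_eq]
  exact Finset.sum_congr rfl fun _ _ => by ring

theorem pull_lower (M : Matrix (Fin 4) (Fin 4) ℝ) (X : Coord → Fin 4 → ℝ) (i : Fin 4) :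
    pull M (S.lower X y) i = ∑ b, pull M (fun a => S.g y a b) i * X y b := by
  change pull M (fun a => ∑ b, S.g y a b * X y b) i = _
  simp only [pull_sum, pull_mul_const]

theorem lower_raise (fr : IsAdaptedFrame S y M σ) (L : Coord → Fin 4 → ℝ) (a : Fin 4) :
    S.lower (S.raise L) y a = L y a := by
  have key : pull M (S.lower (S.raise L) y) = pull M (L y) := by
    funext i
    rw [pull_lower, fr.sum_mul_raise]
    have : ∀ k, pull M (fun b => pull M (fun a => S.g y a b) i) k = _ := fun k =>
      (pull_comm M (fun a b => S.g y a b) i k).symm.trans (fr.pull_g i k)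
    simp only [this]
    simp [minkSign]
    split_ifs <;> simp
  exact congrFun (pull_injective fr.isUnit_det key) a

theorem isUnit_det_g (fr : IsAdaptedFrame S y M σ) : IsUnit (S.g y).det := by
  refine Matrix.isUnit_det_of_right_inverse (B := (S.g y)⁻¹) ?_
  ext a b
  have h := fr.lower_raise (fun _ c => if c = b then 1 else 0) a
  simpa [Fields.lower, Fields.raise, Fields.gUp, Matrix.mul_apply, Matrix.one_apply] using h

theorem raise_lower (fr : IsAdaptedFrame S y M σ) (X : Coord → Fin 4 → ℝ) (a : Fin 4) :
    S.raise (S.lower X) y a = X y a := by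
  have h := congrFun (Matrix.mulVec_mulVec (X y) (S.g y)⁻¹ (S.g y)) a
  rw [Matrix.nonsing_inv_mul _ fr.isUnit_det_g, Matrix.one_mulVec] at h
  exact h

theorem sum_raise_mul_comm (fr : IsAdaptedFrame S y M σ) (L K : Coord → Fin 4 → ℝ) :
    ∑ a, S.raise L y a * K y a = ∑ a, L y a * S.raise K y a := by
  have : ∀ a, S.raise L y a * K y a = K y a * S.raise L y a := fun a => mul_comm _ _
  simp only [this, fr.sum_mul_raise]
  exact Finset.sum_congr rfl fun _ _ => by ring

theorem sum_lower_mul_comm (fr : IsAdaptedFrame S y M σ) (X Y : Coord → Fin 4 → ℝ) :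
    ∑ a, S.lower X y a * Y y a = ∑ a, X y a * S.lower Y y a := by
  simp only [Fields.lower, Finset.mul_sum, Finset.sum_mul]
  rw [Finset.sum_comm]
  exact Finset.sum_congr rfl fun a _ => Finset.sum_congr rfl fun b _ => by
    rw [fr.g_symm a b]; ring

theorem sum_raiseSecond_mul_lower (fr : IsAdaptedFrame S y M σ) (T : Coord → Fin 4 → Fin 4 → ℝ)
    (X : Coord → Fin 4 → ℝ) (a : Fin 4) :
    ∑ b, S.raiseSecond T y a b * S.lower X y b = ∑ b, T y a b * X y b := by
  simp only [raiseSecond_eq_raise]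
  rw [fr.sum_raise_mul_comm (fun z => T z a) (S.lower X)]
  simp only [fr.raise_lower]

theorem sum_nDown_mul_n (fr : IsAdaptedFrame S y M σ) : ∑ a, S.nDown y a * S.n y a = -1 := by
  rw [fr.sum_mul_n, fr.pull_nDown]; simp

theorem sum_E_mul_n (fr : IsAdaptedFrame S y M σ) : ∑ a, S.E y a * S.n y a = 0 := by
  rw [fr.sum_mul_n, fr.pull_E]
  linarith [fr.pull_F 0 0]

theorem sum_B_mul_n (fr : IsAdaptedFrame S y M σ) : ∑ a, S.B y a * S.n y a = 0 := by
  rw [fr.sum_mul_n, fr.pull_B, fr.pull_FDual]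
  simp [leviCivita]

theorem sum_P_mul_n (fr : IsAdaptedFrame S y M σ) : ∑ a, S.P y a * S.n y a = 0 := by
  rw [fr.sum_mul_n, fr.pull_P]
  simp [leviCivita]

theorem eps_swap (fr : IsAdaptedFrame S y M σ) (a b c : Fin 4) :
    S.eps y a b c = - S.eps y a c b := by
  rw [Fields.eps, Fields.eps, ← Finset.sum_neg_distrib]
  exact Finset.sum_congr rfl fun d _ => by
    rw [fr.η_eq d a b c, fr.η_eq d a c b]; simp only [leviCivita]; ring

theorem sum_n_mul_eps (fr : IsAdaptedFrame S y M σ) (b c : Fin 4) :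
    ∑ a, S.n y a * S.eps y a b c = 0 := by
  -- The tensor `n^a n^d η_dabc` changes sign when `a` and `d` are exchanged.
  have h : ∑ a, S.n y a * S.eps y a b c = - ∑ a, S.n y a * S.eps y a b c := by
    simp only [Fields.eps, Finset.mul_sum]
    conv_lhs => rw [Finset.sum_comm]
    rw [← Finset.sum_neg_distrib]
    refine Finset.sum_congr rfl fun d _ => ?_
    rw [← Finset.sum_neg_distrib]
    exact Finset.sum_congr rfl fun a _ => by
      rw [fr.η_eq d a b c, fr.η_eq a d b c]; simp only [leviCivita]; ring
  linarith

theorem h_mul_n (fr : IsAdaptedFrame S y M σ) (a : Fin 4) : ∑ b, S.h y a b * S.n y b = 0 := by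
  have h := fr.sum_nDown_mul_n
  have h2 : ∑ b, S.h y a b * S.n y b = S.nDown y a + S.nDown y a * ∑ b, S.nDown y b * S.n y b := by
    simp only [Fields.h, add_mul, Finset.sum_add_distrib, Finset.mul_sum, mul_assoc]
    rfl
  rw [h2, h]; ring

theorem stress_mul_n (fr : IsAdaptedFrame S y M σ) (a : Fin 4) :
    ∑ b, S.stress y a b * S.n y b = 0 := by
  have h : ∑ b, S.stress y a b * S.n y b = S.U y * (∑ b, S.h y a b * S.n y b)
      - S.E y a * (∑ b, S.E y b * S.n y b) - S.B y a * ∑ b, S.B y b * S.n y b := by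
    simp only [Fields.stress, sub_mul, Finset.sum_sub_distrib, Finset.mul_sum, mul_assoc]
  rw [h, fr.h_mul_n, fr.sum_E_mul_n, fr.sum_B_mul_n]; ring

theorem h_symm (fr : IsAdaptedFrame S y M σ) (a b : Fin 4) : S.h y a b = S.h y b a := by
  rw [Fields.h, Fields.h, fr.g_symm a b]; ring

theorem stress_symm (fr : IsAdaptedFrame S y M σ) (a b : Fin 4) :
    S.stress y a b = S.stress y b a := by
  rw [Fields.stress, Fields.stress, fr.h_symm a b]; ring

theorem raise_nDown (fr : IsAdaptedFrame S y M σ) (a : Fin 4) : S.raise S.nDown y a = S.n y a :=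
  fr.raise_lower S.n a

theorem hMix_eq (fr : IsAdaptedFrame S y M σ) (a b : Fin 4) :
    S.hMix y a b = (if a = b then 1 else 0) + S.n y a * S.nDown y b := by
  have h := fr.raise_lower (fun _ c => if c = b then 1 else 0) a
  have h2 := fr.raise_nDown a
  simp only [Fields.raise, Fields.lower] at h h2
  rw [← h, ← h2]
  simp [Fields.hMix, Fields.raiseFirst, Fields.h, mul_add, Finset.sum_add_distrib, Finset.sum_mul,
    mul_assoc]

/-- The spatial trace of the Maxwell stress tensor is the energy density, `3 U - E² - B² = U`. -/
theorem trace_stress (fr : IsAdaptedFrame S y M σ) :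
    ∑ a, ∑ b, S.raiseBoth S.stress y a b * S.h y a b = S.U y := by
  have h1 : ∀ a b, S.raiseBoth S.stress y a b * S.h y a b =
    S.h y a b * S.raiseBoth S.stress y a b := fun a b => mul_comm _ _
  simp only [h1, fr.sum_mul_raiseBoth, pull_stress, fr.pull_h]
  have hU := fr.U_eq
  have hE : pull M (S.E y) 0 = 0 := by rw [← fr.sum_mul_n, fr.sum_E_mul_n]
  have hB : pull M (S.B y) 0 = 0 := by rw [← fr.sum_mul_n, fr.sum_B_mul_n]
  simp [Fin.sum_univ_four, minkSign, hE, hB] at hU ⊢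
  linarith

theorem raiseFirst_energyMomentum (fr : IsAdaptedFrame S y M σ) (b a : Fin 4) :
    S.raiseFirst S.energyMomentum y b a =
      (S.U y * S.n y b + S.raise S.P y b) * S.nDown y a + S.n y b * S.P y a
        + S.raiseFirst S.stress y b a := by
  have h2 := fr.raise_nDown b
  rw [← h2]
  simp only [Fields.raiseFirst, Fields.raise, fr.energyMomentum_eq, Finset.mul_sum,
    Finset.sum_mul, add_mul, ← Finset.sum_add_distrib]
  exact Finset.sum_congr rfl fun _ _ => by ring

theorem raiseFirst_stress_mul_n (fr : IsAdaptedFrame S y M σ) (b : Fin 4) :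
    ∑ a, S.raiseFirst S.stress y b a * S.n y a = 0 := by
  have h : ∑ a, S.raiseFirst S.stress y b a * S.n y a =
      ∑ c, S.gUp y b c * ∑ a, S.stress y c a * S.n y a := by
    simp only [Fields.raiseFirst, Finset.sum_mul, Finset.mul_sum, mul_assoc]
    rw [Finset.sum_comm]
  simp [h, fr.stress_mul_n]

theorem sum_mul_raiseFirst (fr : IsAdaptedFrame S y M σ) (L : Coord → Fin 4 → ℝ)
    (T : Coord → Fin 4 → Fin 4 → ℝ) (a : Fin 4) :
    ∑ b, L y b * S.raiseFirst T y b a = ∑ b, S.raise L y b * T y b a := by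
  exact (fr.sum_raise_mul_comm L fun z b => T z b a).symm

theorem nDown_mul_raiseFirst_stress (fr : IsAdaptedFrame S y M σ) (a : Fin 4) :
    ∑ b, S.nDown y b * S.raiseFirst S.stress y b a = 0 := by
  rw [fr.sum_mul_raiseFirst]
  simp only [fr.raise_nDown, fr.stress_symm _ a, ← fr.stress_mul_n a]
  exact Finset.sum_congr rfl fun _ _ => mul_comm _ _

theorem nDown_mul_raise_P (fr : IsAdaptedFrame S y M σ) :
    ∑ a, S.nDown y a * S.raise S.P y a = 0 := by
  rw [← fr.sum_raise_mul_comm, ← fr.sum_P_mul_n]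
  simp only [fr.raise_nDown]
  exact Finset.sum_congr rfl fun _ _ => mul_comm _ _

theorem J_eq (fr : IsAdaptedFrame S y M σ) (a : Fin 4) :
    S.J y a = S.ρ y * S.n y a - S.j y a := by
  have h1 : ∀ c, S.hUp y a c = S.gUp y a c + S.n y a * S.n y c := by
    intro c
    have e : S.hUp y a c = ∑ e, S.gUp y c e * S.hMix y a e := by
      simp only [Fields.hUp, Fields.raiseBoth, Fields.hMix, Fields.raiseFirst, Finset.mul_sum]
      rw [Finset.sum_comm]
      exact Finset.sum_congr rfl fun _ _ => Finset.sum_congr rfl fun _ _ => by ring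
    rw [e, ← fr.raise_nDown c, fr.gUp_symm a c]
    simp only [fr.hMix_eq, Fields.raise, mul_add, Finset.sum_add_distrib, Finset.mul_sum]
    congr 1
    · simp
    · exact Finset.sum_congr rfl fun _ _ => by ring
  have h2 := fr.raise_lower S.j a
  have h3 : ∑ c, S.n y c * S.lower S.j y c = ∑ c, S.j y c * S.nDown y c := by
    rw [← fr.sum_lower_mul_comm]
    exact Finset.sum_congr rfl fun _ _ => mul_comm _ _
  rw [Fields.raise] at h2
  simp only [Fields.J, h1, Fields.ρ, ← h3, add_mul, Finset.sum_add_distrib, h2, mul_assoc,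
    ← Finset.mul_sum]
  ring

theorem nDown_mul_J (fr : IsAdaptedFrame S y M σ) : ∑ a, S.nDown y a * S.J y a = 0 := by
  simp only [fr.J_eq, mul_sub, Finset.sum_sub_distrib]
  have h : ∑ a, S.nDown y a * (S.ρ y * S.n y a) = S.ρ y * ∑ a, S.nDown y a * S.n y a := by
    rw [Finset.mul_sum]; exact Finset.sum_congr rfl fun _ _ => by ring
  rw [h, fr.sum_nDown_mul_n, Fields.ρ]
  simp [mul_comm]

/-- The Lorentz force density, split by the observer. -/
theorem lorentz_force (fr : IsAdaptedFrame S y M σ) (a : Fin 4) :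
    ∑ b, S.raiseSecond S.F y a b * S.lower S.j y b = S.ρ y * S.E y a
      - S.nDown y a * (∑ b, S.raise S.E y b * S.lower S.J y b)
      - ∑ b, ∑ c, S.eps y a b c * S.raise S.B y b * S.J y c := by
  have h0 : ∑ b, S.raise S.E y b * S.lower S.J y b = ∑ b, S.E y b * S.J y b := by
    rw [fr.sum_raise_mul_comm]
    simp only [fr.raise_lower]
  rw [fr.sum_raiseSecond_mul_lower, h0]
  have hj : ∀ b, S.j y b = S.ρ y * S.n y b - S.J y b := fun b => by rw [fr.J_eq]; ring
  have h1 : ∑ b, S.F y a b * S.j y b = S.ρ y * S.E y a - ∑ b, S.F y a b * S.J y b := by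
    simp only [hj, mul_sub, Finset.sum_sub_distrib, Fields.E, Finset.mul_sum]
    congr 1
    exact Finset.sum_congr rfl fun _ _ => by ring
  have h2 : ∑ b, S.F y a b * S.J y b = S.nDown y a * (∑ b, S.E y b * S.J y b)
      - S.E y a * (∑ b, S.nDown y b * S.J y b)
      - ∑ b, (∑ c, S.eps y a b c * S.raise S.B y c) * S.J y b := by
    simp only [Finset.mul_sum, ← Finset.sum_sub_distrib]
    exact Finset.sum_congr rfl fun b _ => by rw [fr.F_eq a b]; ring
  have h3 : ∑ b, (∑ c, S.eps y a b c * S.raise S.B y c) * S.J y b =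
      - ∑ b, ∑ c, S.eps y a b c * S.raise S.B y b * S.J y c := by
    simp only [Finset.sum_mul]
    rw [Finset.sum_comm, ← Finset.sum_neg_distrib]
    refine Finset.sum_congr rfl fun b _ => ?_
    rw [← Finset.sum_neg_distrib]
    exact Finset.sum_congr rfl fun c _ => by rw [fr.eps_swap a b c]; ring
  rw [h1, h2, h3, fr.nDown_mul_J]
  ring

end IsAdaptedFrame

/-! ### Regularity of the derived fields -/

/-- All that the equivalence of the two systems at `y` needs to know about the fields: they are
differentiable at `y`, and adapted frames exist at all points near `y`. -/
structure IsRegularAt (S : Fields) (y : Coord) : Prop where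
  frame : ∀ᶠ z in 𝓝 y, ∃ M σ, IsAdaptedFrame S z M σ
  diff_g : ∀ a b, DifferentiableAt ℝ (fun z => S.g z a b) y
  diff_η : ∀ a b c d, DifferentiableAt ℝ (fun z => S.η z a b c d) y
  diff_n : ∀ a, DifferentiableAt ℝ (fun z => S.n z a) y
  diff_F : ∀ a b, DifferentiableAt ℝ (fun z => S.F z a b) y
  diff_j : ∀ a, DifferentiableAt ℝ (fun z => S.j z a) y

theorem differentiableAt_det {A : Coord → Matrix (Fin 4) (Fin 4) ℝ} {y : Coord}
    (hA : ∀ a b, DifferentiableAt ℝ (fun z => A z a b) y) :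
    DifferentiableAt ℝ (fun z => (A z).det) y := by
  simp only [det_fin_four]
  fun_prop

namespace IsRegularAt

variable {S : Fields} {y : Coord}

theorem isUnit_det (hS : IsRegularAt S y) : IsUnit (S.g y).det :=
  let ⟨_, _, fr⟩ := hS.frame.self_of_nhds
  fr.isUnit_det_g

theorem diff_gUp (hS : IsRegularAt S y) (a b : Fin 4) :
    DifferentiableAt ℝ (fun z => S.gUp z a b) y := by
  have h : ∀ z, S.gUp z a b = (S.g z).det⁻¹ * ((S.g z).updateRow b (Pi.single a 1)).det := by
    intro z
    simp [Fields.gUp, Matrix.inv_def, Matrix.adjugate_apply, Ring.inverse_eq_inv']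
  simp only [h]
  refine ((differentiableAt_det hS.diff_g).fun_inv hS.isUnit_det.ne_zero).fun_mul
    (differentiableAt_det fun i k => ?_)
  simp only [Matrix.updateRow_apply]
  split_ifs
  · fun_prop
  · exact hS.diff_g i k

theorem diff_lower (hS : IsRegularAt S y) {X : Coord → Fin 4 → ℝ}
    (hX : ∀ a, DifferentiableAt ℝ (fun z => X z a) y) (a : Fin 4) :
    DifferentiableAt ℝ (fun z => S.lower X z a) y := by
  have := hS.diff_g
  simp only [Fields.lower]
  fun_prop

theorem diff_raise (hS : IsRegularAt S y) {L : Coord → Fin 4 → ℝ}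
    (hL : ∀ a, DifferentiableAt ℝ (fun z => L z a) y) (a : Fin 4) :
    DifferentiableAt ℝ (fun z => S.raise L z a) y := by
  have := hS.diff_gUp
  simp only [Fields.raise]
  fun_prop

theorem diff_nDown (hS : IsRegularAt S y) (a : Fin 4) :
    DifferentiableAt ℝ (fun z => S.nDown z a) y := hS.diff_lower hS.diff_n a

theorem diff_E (hS : IsRegularAt S y) (a : Fin 4) :
    DifferentiableAt ℝ (fun z => S.E z a) y := by
  have := hS.diff_F
  have := hS.diff_n
  simp only [Fields.E]
  fun_prop

theorem diff_B (hS : IsRegularAt S y) (a : Fin 4) :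
    DifferentiableAt ℝ (fun z => S.B z a) y := by
  have := hS.diff_F
  have := hS.diff_n
  have := hS.diff_η
  have := hS.diff_gUp
  simp only [Fields.B, Fields.FDual, Fields.raiseBoth]
  fun_prop

theorem diff_U (hS : IsRegularAt S y) : DifferentiableAt ℝ S.U y := by
  have := hS.diff_E
  have := hS.diff_B
  have := hS.diff_raise hS.diff_E
  have := hS.diff_raise hS.diff_B
  unfold Fields.U
  fun_prop

theorem diff_P (hS : IsRegularAt S y) (a : Fin 4) :
    DifferentiableAt ℝ (fun z => S.P z a) y := by
  have := hS.diff_n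
  have := hS.diff_η
  have := hS.diff_raise hS.diff_E
  have := hS.diff_raise hS.diff_B
  simp only [Fields.P, Fields.eps]
  fun_prop

theorem diff_stressMixed (hS : IsRegularAt S y) (a b : Fin 4) :
    DifferentiableAt ℝ (fun z => S.raiseFirst S.stress z a b) y := by
  have := hS.diff_gUp
  have := hS.diff_g
  have := hS.diff_nDown
  have := hS.diff_E
  have := hS.diff_B
  have := hS.diff_U
  simp only [Fields.raiseFirst, Fields.stress, Fields.h]
  fun_prop

theorem diff_ρ (hS : IsRegularAt S y) : DifferentiableAt ℝ S.ρ y := by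
  have := hS.diff_j
  have := hS.diff_nDown
  unfold Fields.ρ
  fun_prop

theorem diff_J (hS : IsRegularAt S y) (a : Fin 4) :
    DifferentiableAt ℝ (fun z => S.J z a) y := by
  have := hS.diff_ρ
  have := hS.diff_n
  have := hS.diff_j
  have h : ∀ᶠ z in 𝓝 y, S.J z a = S.ρ z * S.n z a - S.j z a :=
    hS.frame.mono fun z ⟨_, _, fr⟩ => fr.J_eq a
  refine DifferentiableAt.congr_of_eventuallyEq ?_ h
  fun_prop

theorem symm_g (hS : IsRegularAt S y) : ∀ᶠ z in 𝓝 y, ∀ a b, S.g z a b = S.g z b a :=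
  hS.frame.mono fun _ ⟨_, _, fr⟩ => fr.g_symm

theorem nablaCov_nDown (hS : IsRegularAt S y) (a b : Fin 4) :
    S.nablaCov S.nDown y a b = ∑ c, S.g y b c * S.nablaVec S.n y a c :=
  Fields.nablaCov_lower hS.isUnit_det hS.symm_g hS.diff_g hS.diff_n a b

/-- If the contraction of `L` and `X` is constant, its derivative vanishes. -/
theorem pairing_const (c : ℝ) {L X : Coord → Fin 4 → ℝ}
    (hL : ∀ a, DifferentiableAt ℝ (fun z => L z a) y)
    (hX : ∀ a, DifferentiableAt ℝ (fun z => X z a) y)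
    (h : ∀ᶠ z in 𝓝 y, ∑ b, L z b * X z b = c) (a : Fin 4) :
    ∑ b, S.nablaCov L y a b * X y b = - ∑ b, L y b * S.nablaVec X y a b := by
  have h1 := Fields.pd_pairing (S := S) hL hX a
  rw [pd_congr h a, pd_const, Finset.sum_add_distrib] at h1
  linarith

theorem sum_nDown_mul_nablaVec_n (hS : IsRegularAt S y) (a : Fin 4) :
    ∑ b, S.nDown y b * S.nablaVec S.n y a b = 0 := by
  obtain ⟨_, _, fr⟩ := hS.frame.self_of_nhds
  have h := pairing_const (S := S) (-1) hS.diff_nDown hS.diff_n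
    (hS.frame.mono fun _ ⟨_, _, fr⟩ => fr.sum_nDown_mul_n) a
  have h2 : ∑ b, S.nablaCov S.nDown y a b * S.n y b = ∑ b, S.nDown y b * S.nablaVec S.n y a b := by
    simp only [hS.nablaCov_nDown]
    exact fr.sum_lower_mul_comm (fun _ => S.nablaVec S.n y a) S.n |>.trans
      (Finset.sum_congr rfl fun _ _ => mul_comm _ _)
  linarith

theorem sum_nablaCov_nDown_mul_n (hS : IsRegularAt S y) (a : Fin 4) :
    ∑ b, S.nablaCov S.nDown y a b * S.n y b = 0 := by
  have h := pairing_const (S := S) (-1) hS.diff_nDown hS.diff_n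
    (hS.frame.mono fun _ ⟨_, _, fr⟩ => fr.sum_nDown_mul_n) a
  rw [h, hS.sum_nDown_mul_nablaVec_n, neg_zero]

theorem sum_n_mul_nablaCov_nDown (hS : IsRegularAt S y) (a : Fin 4) :
    ∑ c, S.n y c * S.nablaCov S.nDown y c a = S.lower S.accel y a := by
  simp only [hS.nablaCov_nDown, Fields.lower, Fields.accel, Finset.mul_sum]
  rw [Finset.sum_comm]
  exact Finset.sum_congr rfl fun _ _ => Finset.sum_congr rfl fun _ _ => by ring

theorem sum_nablaCov_P_mul_n (hS : IsRegularAt S y) (a : Fin 4) :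
    ∑ b, S.nablaCov S.P y a b * S.n y b = - ∑ b, S.P y b * S.nablaVec S.n y a b :=
  pairing_const 0 hS.diff_P hS.diff_n (hS.frame.mono fun _ ⟨_, _, fr⟩ => fr.sum_P_mul_n) a

theorem sum_nablaMixed_stress_mul_n (hS : IsRegularAt S y) (c b : Fin 4) :
    ∑ a, S.nablaMixed (S.raiseFirst S.stress) y c b a * S.n y a =
      - ∑ a, S.raiseFirst S.stress y b a * S.nablaVec S.n y c a := by
  have h := Fields.nablaVec_contract (S := S) hS.diff_stressMixed hS.diff_n c b
  rw [Fields.nablaVec_congr (X' := fun _ _ => 0)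
    (hS.frame.mono fun _ ⟨_, _, fr⟩ => funext fr.raiseFirst_stress_mul_n), Fields.nablaVec_zero,
    Finset.sum_add_distrib] at h
  linarith

theorem sum_nDown_mul_nablaMixed_stress (hS : IsRegularAt S y) (c a : Fin 4) :
    ∑ b, S.nDown y b * S.nablaMixed (S.raiseFirst S.stress) y c b a =
      - ∑ b, S.nablaCov S.nDown y c b * S.raiseFirst S.stress y b a := by
  have h := Fields.nablaCov_contract (S := S) hS.diff_stressMixed hS.diff_nDown c a
  rw [Fields.nablaCov_congr (X' := fun _ _ => 0)
    (hS.frame.mono fun _ ⟨_, _, fr⟩ => funext fr.nDown_mul_raiseFirst_stress), Fields.nablaCov_zero,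
    Finset.sum_add_distrib] at h
  linarith

end IsRegularAt

/-! ### The Cattaneo operator and the kinematical quantities -/

namespace IsAdaptedFrame

variable {S : Fields} {y : Coord} {M : Matrix (Fin 4) (Fin 4) ℝ} {σ : ℝ}

theorem sum_hMix_mul (fr : IsAdaptedFrame S y M σ) (X : Fin 4 → ℝ) (a : Fin 4) :
    ∑ e, S.hMix y e a * X e = X a + S.nDown y a * ∑ e, X e * S.n y e := by
  simp only [fr.hMix_eq, add_mul, Finset.sum_add_distrib, Finset.mul_sum]
  congr 1
  · simp
  · exact Finset.sum_congr rfl fun _ _ => by ring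

theorem hMix_idem (fr : IsAdaptedFrame S y M σ) (c d : Fin 4) :
    ∑ a, S.hMix y c a * S.hMix y a d = S.hMix y c d := by
  have h : ∑ a, S.hMix y c a * S.hMix y a d = ∑ a, S.hMix y a d * S.hMix y c a :=
    Finset.sum_congr rfl fun _ _ => mul_comm _ _
  have h2 : ∑ e, S.hMix y c e * S.n y e = S.n y c + S.n y c * ∑ e, S.nDown y e * S.n y e := by
    simp only [fr.hMix_eq, add_mul, Finset.sum_add_distrib, Finset.mul_sum, mul_assoc]
    simp
  rw [h, fr.sum_hMix_mul, h2, fr.sum_nDown_mul_n]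
  ring

theorem sum_hMix_mul_pair (fr : IsAdaptedFrame S y M σ) (D : Fin 4 → Fin 4 → ℝ) :
    ∑ c, ∑ d, S.hMix y c d * D c d = ∑ c, D c c + ∑ c, S.n y c * ∑ d, S.nDown y d * D c d := by
  simp only [fr.hMix_eq, add_mul, Finset.sum_add_distrib, Finset.mul_sum]
  congr 1
  · simp
  · exact Finset.sum_congr rfl fun _ _ => Finset.sum_congr rfl fun _ _ => by ring

theorem sum_cattaneoVec (fr : IsAdaptedFrame S y M σ) (X : Coord → Fin 4 → ℝ) :
    ∑ a, S.cattaneoVec X y a a = ∑ a, S.nablaVec X y a a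
      + ∑ c, S.n y c * ∑ d, S.nDown y d * S.nablaVec X y c d := by
  have h : ∀ c d, S.hMix y c d * S.nablaVec X y c d =
      ∑ a, S.hMix y c a * S.hMix y a d * S.nablaVec X y c d := fun c d => by
    rw [← Finset.sum_mul, fr.hMix_idem]
  rw [← fr.sum_hMix_mul_pair]
  simp only [h, Fields.cattaneoVec]
  rw [Finset.sum_comm]
  exact Finset.sum_congr rfl fun _ _ => Finset.sum_comm

theorem sum_cattaneoMixed (fr : IsAdaptedFrame S y M σ) (T : Coord → Fin 4 → Fin 4 → ℝ)
    (a : Fin 4) :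
    ∑ b, S.cattaneoMixed T y b b a = ∑ e, S.hMix y e a * (∑ b, S.nablaMixed T y b b e
      + ∑ c, S.n y c * ∑ d, S.nDown y d * S.nablaMixed T y c d e) := by
  have h' : ∀ c d e, S.hMix y c d * S.nablaMixed T y c d e =
      ∑ b, S.hMix y c b * S.hMix y b d * S.nablaMixed T y c d e := fun c d e => by
    rw [← Finset.sum_mul, fr.hMix_idem]
  have h0 : ∀ e, ∑ b, S.nablaMixed T y b b e + ∑ c, S.n y c * ∑ d, S.nDown y d *
      S.nablaMixed T y c d e = ∑ c, ∑ d, S.hMix y c d * S.nablaMixed T y c d e := fun e =>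
    (fr.sum_hMix_mul_pair fun c d => S.nablaMixed T y c d e).symm
  simp only [h0, h']
  simp only [Fields.cattaneoMixed, Finset.mul_sum]
  have h : ∀ b, ∑ f, ∑ d, ∑ e, S.hMix y f b * S.hMix y b d * S.hMix y e a * S.nablaMixed T y f d e
    = ∑ e, ∑ f, ∑ d, S.hMix y f b * S.hMix y b d * S.hMix y e a * S.nablaMixed T y f d e := by
    intro b
    rw [Finset.sum_comm (s := Finset.univ (α := Fin 4)) (t := Finset.univ (α := Fin 4))
      (f := fun e f => ∑ d, S.hMix y f b * S.hMix y b d * S.hMix y e a * S.nablaMixed T y f d e)]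
    exact Finset.sum_congr rfl fun _ _ => Finset.sum_comm
  simp only [h]
  rw [Finset.sum_comm]
  refine Finset.sum_congr rfl fun e _ => ?_
  rw [Finset.sum_comm]
  refine Finset.sum_congr rfl fun f _ => ?_
  rw [Finset.sum_comm]
  exact Finset.sum_congr rfl fun d _ => Finset.sum_congr rfl fun b _ => by ring

theorem sum_accel_mul (fr : IsAdaptedFrame S y M σ) (L : Coord → Fin 4 → ℝ) :
    ∑ a, S.lower S.accel y a * S.raise L y a = ∑ a, S.accel y a * L y a := by
  rw [fr.sum_lower_mul_comm]
  simp only [fr.lower_raise]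

end IsAdaptedFrame

namespace IsRegularAt

variable {S : Fields} {y : Coord}

/-- The Cattaneo divergence of a spatial vector field differs from its divergence by a contraction
with the acceleration. -/
theorem cattaneo_divergence (hS : IsRegularAt S y) {X : Coord → Fin 4 → ℝ}
    (hX : ∀ a, DifferentiableAt ℝ (fun z => X z a) y)
    (h : ∀ᶠ z in 𝓝 y, ∑ a, S.nDown z a * X z a = 0) :
    ∑ a, S.cattaneoVec X y a a = ∑ a, S.nablaVec X y a a - ∑ a, S.lower S.accel y a * X y a := by
  obtain ⟨_, _, fr⟩ := hS.frame.self_of_nhds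
  have h1 : ∀ c, ∑ d, S.nDown y d * S.nablaVec X y c d =
      - ∑ d, S.nablaCov S.nDown y c d * X y d := fun c => by
    rw [pairing_const 0 hS.diff_nDown hX h c, neg_neg]
  rw [fr.sum_cattaneoVec]
  simp only [h1, ← hS.sum_n_mul_nablaCov_nDown, Finset.sum_mul, Finset.mul_sum, mul_neg,
    Finset.sum_neg_distrib]
  rw [Finset.sum_comm, ← sub_eq_add_neg]
  simp only [mul_assoc]

theorem sum_accel_mul_nDown (hS : IsRegularAt S y) : ∑ a, S.accel y a * S.nDown y a = 0 := by
  have h : ∑ a, S.accel y a * S.nDown y a =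
      ∑ c, S.n y c * ∑ a, S.nDown y a * S.nablaVec S.n y c a := by
    simp only [Fields.accel, Finset.sum_mul, Finset.mul_sum]
    rw [Finset.sum_comm]
    exact Finset.sum_congr rfl fun _ _ => Finset.sum_congr rfl fun _ _ => by ring
  simp [h, hS.sum_nDown_mul_nablaVec_n]

theorem sum_accel_mul_h (hS : IsRegularAt S y) (a : Fin 4) :
    ∑ b, S.accel y b * S.h y a b = S.lower S.accel y a := by
  have h : ∑ b, S.accel y b * S.h y a b = S.lower S.accel y a +
      S.nDown y a * ∑ b, S.accel y b * S.nDown y b := by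
    simp only [Fields.h, Fields.lower, mul_add, Finset.sum_add_distrib, Finset.mul_sum]
    congr 1 <;> exact Finset.sum_congr rfl fun _ _ => by ring
  rw [h, hS.sum_accel_mul_nDown]; ring

/-- The Cattaneo divergence of the stress tensor is the projected divergence up to a contraction
with the acceleration. -/
theorem cattaneo_stress (hS : IsRegularAt S y) (a : Fin 4) :
    ∑ b, S.cattaneoMixed (S.raiseFirst S.stress) y b b a =
      ∑ b, S.nablaMixed (S.raiseFirst S.stress) y b b a
      + S.nDown y a * (∑ e, (∑ b, S.nablaMixed (S.raiseFirst S.stress) y b b e) * S.n y e)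
      - ∑ b, S.accel y b * S.stress y a b := by
  obtain ⟨_, _, fr⟩ := hS.frame.self_of_nhds
  have h1 : ∀ e, ∑ c, S.n y c * ∑ d, S.nDown y d * S.nablaMixed (S.raiseFirst S.stress) y c d e
      = - ∑ b, S.accel y b * S.stress y b e := by
    intro e
    have h2 : ∑ b, S.accel y b * S.stress y b e =
        ∑ d, S.lower S.accel y d * S.raiseFirst S.stress y d e := by
      rw [fr.sum_mul_raiseFirst]
      simp only [fr.raise_lower]
    rw [h2]
    simp only [hS.sum_nDown_mul_nablaMixed_stress, ← hS.sum_n_mul_nablaCov_nDown, Finset.sum_mul,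
      Finset.mul_sum, mul_neg, Finset.sum_neg_distrib]
    rw [Finset.sum_comm]
    simp only [mul_assoc]
  rw [fr.sum_cattaneoMixed]
  simp only [h1, mul_add, Finset.sum_add_distrib, mul_neg, Finset.sum_neg_distrib,
    fr.sum_hMix_mul]
  have h3 : ∑ e, (∑ b, S.accel y b * S.stress y b e) * S.n y e = 0 := by
    have : ∑ e, (∑ b, S.accel y b * S.stress y b e) * S.n y e =
        ∑ b, S.accel y b * ∑ e, S.stress y b e * S.n y e := by
      simp only [Finset.sum_mul, Finset.mul_sum, mul_assoc]
      rw [Finset.sum_comm]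
    simp [this, fr.stress_mul_n]
  rw [h3]
  simp only [fr.stress_symm _ a]
  ring

theorem projGrad_eq (hS : IsRegularAt S y) (a b : Fin 4) :
    S.projGrad y a b = S.nablaCov S.nDown y a b + S.nDown y a * S.lower S.accel y b := by
  obtain ⟨_, _, fr⟩ := hS.frame.self_of_nhds
  have h1 : ∀ d, ∑ c, S.hMix y d a * S.hMix y c b * S.nablaCov S.nDown y d c =
      S.hMix y d a * S.nablaCov S.nDown y d b := by
    intro d
    simp only [mul_assoc, ← Finset.mul_sum]
    rw [fr.sum_hMix_mul, hS.sum_nablaCov_nDown_mul_n]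
    ring
  simp only [Fields.projGrad, h1]
  rw [fr.sum_hMix_mul (fun d => S.nablaCov S.nDown y d b), ← hS.sum_n_mul_nablaCov_nDown]
  congr 2
  exact Finset.sum_congr rfl fun _ _ => mul_comm _ _

theorem rotation_mul_n (hS : IsRegularAt S y) (a : Fin 4) :
    ∑ b, S.rotation y a b * S.n y b = 0 := by
  obtain ⟨_, _, fr⟩ := hS.frame.self_of_nhds
  have h1 : ∑ b, S.rotation y a b * S.n y b = (1 / 2) *
    ((∑ b, S.nablaCov S.nDown y a b * S.n y b)
      + S.nDown y a * (∑ b, S.lower S.accel y b * S.n y b)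
      - (∑ b, S.n y b * S.nablaCov S.nDown y b a)
      - (∑ b, S.nDown y b * S.n y b) * S.lower S.accel y a) := by
    simp only [Fields.rotation, hS.projGrad_eq, Finset.mul_sum, Finset.sum_mul,
      ← Finset.sum_add_distrib, ← Finset.sum_sub_distrib]
    exact Finset.sum_congr rfl fun _ _ => by ring
  have h2 : ∑ b, S.lower S.accel y b * S.n y b = 0 := by
    rw [fr.sum_lower_mul_comm]; exact hS.sum_accel_mul_nDown
  rw [h1, h2, hS.sum_nablaCov_nDown_mul_n, fr.sum_nDown_mul_n, hS.sum_n_mul_nablaCov_nDown]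
  ring

/-- The vorticity term is the antisymmetric part of `∇n` contracted with the Poynting vector. -/
theorem eps_P_vorticity (hS : IsRegularAt S y) (a : Fin 4) :
    2 * ∑ b, ∑ c, S.eps y a b c * S.raise S.P y b * S.raise S.vorticity y c =
      ∑ b, S.nablaCov S.nDown y a b * S.raise S.P y b
      - ∑ b, S.raise S.P y b * S.nablaCov S.nDown y b a
      + S.nDown y a * ∑ b, S.accel y b * S.P y b := by
  obtain ⟨_, _, fr⟩ := hS.frame.self_of_nhds
  have h1 : ∀ b, S.rotation y a b = ∑ c, S.eps y a b c * S.raise S.vorticity y c := fun b =>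
    fr.eq_eps_dual S.rotation (fun a b => by rw [Fields.rotation, Fields.rotation]; ring)
      hS.rotation_mul_n a b
  have h2 : ∀ b, ∑ c, S.eps y a b c * S.raise S.P y b * S.raise S.vorticity y c =
      S.rotation y a b * S.raise S.P y b := by
    intro b
    rw [h1, Finset.sum_mul]
    exact Finset.sum_congr rfl fun _ _ => by ring
  have h3 : 2 * ∑ b, S.rotation y a b * S.raise S.P y b =
      ∑ b, S.nablaCov S.nDown y a b * S.raise S.P y b
      - ∑ b, S.raise S.P y b * S.nablaCov S.nDown y b a
      + S.nDown y a * (∑ b, S.lower S.accel y b * S.raise S.P y b)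
      - S.lower S.accel y a * ∑ b, S.nDown y b * S.raise S.P y b := by
    simp only [Fields.rotation, hS.projGrad_eq, Finset.mul_sum,
      ← Finset.sum_add_distrib, ← Finset.sum_sub_distrib]
    exact Finset.sum_congr rfl fun _ _ => by ring
  simp only [h2]
  rw [h3, fr.nDown_mul_raise_P, fr.sum_accel_mul]
  ring

/-- The contraction of the stress tensor with `∇n` is its contraction with the shear plus a third of
the expansion times its trace `U`; this is where the coefficient `4/3` in the energy law arises. -/
theorem stress_shear (hS : IsRegularAt S y) :
    ∑ a, ∑ b, S.raiseBoth S.stress y a b * S.shear y a b =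
      ∑ b, ∑ a, S.raiseFirst S.stress y b a * S.nablaVec S.n y b a
      - S.expansion y / 3 * S.U y := by
  obtain ⟨_, _, fr⟩ := hS.frame.self_of_nhds
  have h1 : ∀ a b, S.raiseBoth S.stress y a b =
      S.raise (fun z => S.raiseFirst S.stress z a) y b := by
    intro a b
    simp only [Fields.raiseBoth, Fields.raise, Fields.raiseFirst, Finset.mul_sum]
    rw [Finset.sum_comm]
    exact Finset.sum_congr rfl fun _ _ => Finset.sum_congr rfl fun _ _ => by ring
  have h2 : ∀ a b, S.raiseBoth S.stress y a b = S.raiseBoth S.stress y b a := by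
    intro a b
    simp only [Fields.raiseBoth]
    rw [Finset.sum_comm]
    exact Finset.sum_congr rfl fun _ _ => Finset.sum_congr rfl fun _ _ => by
      rw [fr.stress_symm]; ring
  have h3 : ∀ a, ∑ b, S.raiseBoth S.stress y a b * S.nablaCov S.nDown y a b =
      ∑ b, S.raiseFirst S.stress y a b * S.nablaVec S.n y a b := by
    intro a
    have e := fr.sum_raise_mul_comm (fun z => S.raiseFirst S.stress z a)
      (S.lower fun _ => S.nablaVec S.n y a)
    simp only [fr.raise_lower] at e
    simp only [h1, hS.nablaCov_nDown]
    exact e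
  have h4 : ∀ b, ∑ a, S.raiseBoth S.stress y a b * S.nDown y a = 0 := by
    intro b
    have e := fr.sum_raise_mul_comm (fun z => S.raiseFirst S.stress z b) S.nDown
    simp only [fr.raise_nDown, fr.raiseFirst_stress_mul_n] at e
    simp only [h2 _ b, h1, e]
  have h5 : ∑ a, ∑ b, S.raiseBoth S.stress y a b * S.projGrad y a b =
      ∑ b, ∑ a, S.raiseFirst S.stress y b a * S.nablaVec S.n y b a := by
    simp only [hS.projGrad_eq, mul_add, Finset.sum_add_distrib, h3]
    rw [Finset.sum_comm (f := fun a b =>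
      S.raiseBoth S.stress y a b * (S.nDown y a * S.lower S.accel y b))]
    simp only [← mul_assoc, ← Finset.sum_mul, h4]
    simp
  have h6 : ∑ a, ∑ b, S.raiseBoth S.stress y a b * S.projGrad y b a =
      ∑ a, ∑ b, S.raiseBoth S.stress y a b * S.projGrad y a b := by
    rw [Finset.sum_comm]
    exact Finset.sum_congr rfl fun a _ => Finset.sum_congr rfl fun b _ => by rw [h2]
  have h7 : ∑ a, ∑ b, S.raiseBoth S.stress y a b * S.shear y a b =
      (1 / 2) * (∑ a, ∑ b, S.raiseBoth S.stress y a b * S.projGrad y a b)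
      + (1 / 2) * (∑ a, ∑ b, S.raiseBoth S.stress y a b * S.projGrad y b a)
      - S.expansion y / 3 * ∑ a, ∑ b, S.raiseBoth S.stress y a b * S.h y a b := by
    simp only [Fields.shear, Finset.mul_sum, ← Finset.sum_add_distrib, ← Finset.sum_sub_distrib]
    exact Finset.sum_congr rfl fun a _ => Finset.sum_congr rfl fun b _ => by ring
  rw [h7, h6, h5, fr.trace_stress]
  ring

/-- The divergence of the energy-momentum tensor in terms of the observed quantities. -/
theorem div_energyMomentum (hS : IsRegularAt S y) (a : Fin 4) :
    ∑ b, S.nablaMixed (S.raiseFirst S.energyMomentum) y b b a =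
      (S.lieScalar S.U y + S.U y * S.expansion y + ∑ b, S.nablaVec (S.raise S.P) y b b)
        * S.nDown y a + S.U y * S.lower S.accel y a
      + (∑ b, S.raise S.P y b * S.nablaCov S.nDown y b a) + S.expansion y * S.P y a
      + (∑ b, S.n y b * S.nablaCov S.P y b a)
      + ∑ b, S.nablaMixed (S.raiseFirst S.stress) y b b a := by
  have h1 : ∀ᶠ z in 𝓝 y, S.raiseFirst S.energyMomentum z = fun b a =>
      ((S.U z * S.n z b + S.raise S.P z b) * S.nDown z a + S.n z b * S.P z a)
        + S.raiseFirst S.stress z b a :=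
    hS.frame.mono fun z ⟨_, _, fr⟩ => by
      funext b a; exact fr.raiseFirst_energyMomentum b a
  have dU := hS.diff_U
  have dn := hS.diff_n
  have dN := hS.diff_nDown
  have dP := hS.diff_P
  have dR := hS.diff_raise hS.diff_P
  have h2 : ∀ b, S.nablaMixed (S.raiseFirst S.energyMomentum) y b b a =
      (pd S.U y b * S.n y b + S.U y * S.nablaVec S.n y b b + S.nablaVec (S.raise S.P) y b b)
        * S.nDown y a
      + (S.U y * S.n y b + S.raise S.P y b) * S.nablaCov S.nDown y b a
      + (S.nablaVec S.n y b b * S.P y a + S.n y b * S.nablaCov S.P y b a)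
      + S.nablaMixed (S.raiseFirst S.stress) y b b a := by
    intro b
    rw [Fields.nablaMixed_congr h1, Fields.nablaMixed_add _ hS.diff_stressMixed,
      Fields.nablaMixed_add, Fields.nablaMixed_mul _ dN, Fields.nablaMixed_mul dn dP,
      Fields.nablaVec_add _ dR, Fields.nablaVec_smul dU dn]
    all_goals intros; fun_prop
  simp only [h2, ← hS.sum_n_mul_nablaCov_nDown, Fields.expansion, Fields.lieScalar, Finset.mul_sum,
    Finset.sum_mul, ← Finset.sum_add_distrib]
  exact Finset.sum_congr rfl fun _ _ => by ring

end IsRegularAt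

/-! ### The balance laws -/

namespace Fields

/-- The defect `∇_b T^b_a - F_a^b j_b` of the law of energy and momentum. -/
def residual (S : Fields) (y : Coord) (a : Fin 4) : ℝ :=
  ∑ b, S.nablaMixed (S.raiseFirst S.energyMomentum) y b b a
    - ∑ b, S.raiseSecond S.F y a b * S.lower S.j y b

end Fields

namespace IsRegularAt

variable {S : Fields} {y : Coord}

theorem sum_nablaMixed_stress_trace_mul_n (hS : IsRegularAt S y) :
    ∑ a, (∑ b, S.nablaMixed (S.raiseFirst S.stress) y b b a) * S.n y a =
      - ∑ b, ∑ a, S.raiseFirst S.stress y b a * S.nablaVec S.n y b a := by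
  simp only [Finset.sum_mul]
  rw [Finset.sum_comm]
  simp only [hS.sum_nablaMixed_stress_mul_n, Finset.sum_neg_distrib]

theorem residual_mul_n (hS : IsRegularAt S y) :
    ∑ a, S.residual y a * S.n y a =
      - (S.lieScalar S.U y + S.U y * S.expansion y + ∑ b, S.nablaVec (S.raise S.P) y b b)
      - (∑ a, S.accel y a * S.P y a)
      - (∑ b, ∑ a, S.raiseFirst S.stress y b a * S.nablaVec S.n y b a)
      - ∑ a, S.raise S.E y a * S.lower S.J y a := by
  obtain ⟨_, _, fr⟩ := hS.frame.self_of_nhds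
  have e1 : ∑ a, S.residual y a * S.n y a =
      (S.lieScalar S.U y + S.U y * S.expansion y + ∑ b, S.nablaVec (S.raise S.P) y b b)
        * (∑ a, S.nDown y a * S.n y a) + S.U y * (∑ a, S.lower S.accel y a * S.n y a)
      + (∑ a, (∑ b, S.raise S.P y b * S.nablaCov S.nDown y b a) * S.n y a)
      + S.expansion y * (∑ a, S.P y a * S.n y a)
      + (∑ a, (∑ b, S.n y b * S.nablaCov S.P y b a) * S.n y a)
      + (∑ a, (∑ b, S.nablaMixed (S.raiseFirst S.stress) y b b a) * S.n y a)
      - S.ρ y * (∑ a, S.E y a * S.n y a)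
      + (∑ a, S.nDown y a * S.n y a) * (∑ b, S.raise S.E y b * S.lower S.J y b)
      + ∑ a, (∑ b, ∑ c, S.eps y a b c * S.raise S.B y b * S.J y c) * S.n y a := by
    simp only [Fields.residual, hS.div_energyMomentum, fr.lorentz_force]
    rw [Finset.mul_sum, Finset.mul_sum, Finset.mul_sum, Finset.mul_sum,
      Finset.sum_mul (s := Finset.univ) (f := fun a => S.nDown y a * S.n y a)]
    simp only [← Finset.sum_add_distrib, ← Finset.sum_sub_distrib]
    exact Finset.sum_congr rfl fun _ _ => by ring
  have e2 : ∑ a, S.lower S.accel y a * S.n y a = 0 := by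
    rw [fr.sum_lower_mul_comm]; exact hS.sum_accel_mul_nDown
  have e3 : ∑ a, (∑ b, S.raise S.P y b * S.nablaCov S.nDown y b a) * S.n y a = 0 := by
    simp only [Finset.sum_mul, mul_assoc]
    rw [Finset.sum_comm]
    simp only [← Finset.mul_sum, hS.sum_nablaCov_nDown_mul_n, mul_zero, Finset.sum_const_zero]
  have e4 : ∑ a, (∑ b, S.n y b * S.nablaCov S.P y b a) * S.n y a =
      - ∑ a, S.accel y a * S.P y a := by
    simp only [Finset.sum_mul, mul_assoc]
    rw [Finset.sum_comm]
    simp only [← Finset.mul_sum, hS.sum_nablaCov_P_mul_n, Fields.accel, Finset.sum_mul,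
      mul_neg, Finset.sum_neg_distrib]
    simp only [Finset.mul_sum]
    rw [Finset.sum_comm]
    congr 1
    exact Finset.sum_congr rfl fun _ _ => Finset.sum_congr rfl fun _ _ => by ring
  have e6 : ∑ a, (∑ b, ∑ c, S.eps y a b c * S.raise S.B y b * S.J y c) * S.n y a = 0 := by
    have : ∀ a, (∑ b, ∑ c, S.eps y a b c * S.raise S.B y b * S.J y c) * S.n y a =
        ∑ b, ∑ c, (S.n y a * S.eps y a b c) * (S.raise S.B y b * S.J y c) := fun a => by
      simp only [Finset.sum_mul]
      exact Finset.sum_congr rfl fun _ _ => Finset.sum_congr rfl fun _ _ => by ring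
    simp only [this]
    rw [Finset.sum_comm]
    refine Finset.sum_eq_zero fun b _ => ?_
    rw [Finset.sum_comm]
    refine Finset.sum_eq_zero fun c _ => ?_
    rw [← Finset.sum_mul, fr.sum_n_mul_eps, zero_mul]
  rw [e1, e2, e3, e4, hS.sum_nablaMixed_stress_trace_mul_n, e6,
    fr.sum_nDown_mul_n, fr.sum_P_mul_n, fr.sum_E_mul_n]
  ring

/-- The defect of the energy law is minus the component along `n` of the residual. -/
theorem energy_balance (hS : IsRegularAt S y) :
    S.lieScalar S.U y -
    (- (∑ a, S.raise S.E y a * S.lower S.J y a)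
    - 2 * (∑ a, S.accel y a * S.P y a)
    - 4 / 3 * S.U y * S.expansion y
    - (∑ a, ∑ b, S.raiseBoth S.stress y a b * S.shear y a b)
    - ∑ a, S.cattaneoVec (S.raise S.P) y a a) = - ∑ a, S.residual y a * S.n y a := by
  obtain ⟨_, _, fr⟩ := hS.frame.self_of_nhds
  rw [hS.stress_shear, hS.cattaneo_divergence (hS.diff_raise hS.diff_P)
    (hS.frame.mono fun _ ⟨_, _, fr⟩ => fr.nDown_mul_raise_P), fr.sum_accel_mul,
    hS.residual_mul_n]
  ring

/-- The defect of the momentum law is the spatial projection of the residual. -/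
theorem momentum_balance (hS : IsRegularAt S y) (a : Fin 4) :
    S.lieCov S.P y a -
    (- (∑ b, ∑ c, S.eps y a b c * S.raise S.B y b * S.J y c)
    + S.E y a * S.ρ y
    + 2 * (∑ b, ∑ c, S.eps y a b c * S.raise S.P y b * S.raise S.vorticity y c)
    - S.P y a * S.expansion y
    - (∑ b, S.accel y b * (S.U y * S.h y a b + S.stress y a b))
    - ∑ b, S.cattaneoMixed (S.raiseFirst S.stress) y b b a) =
      S.residual y a + S.nDown y a * ∑ b, S.residual y b * S.n y b := by
  obtain ⟨_, _, fr⟩ := hS.frame.self_of_nhds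
  have h1 : ∑ b, S.accel y b * (S.U y * S.h y a b + S.stress y a b) =
      S.U y * S.lower S.accel y a + ∑ b, S.accel y b * S.stress y a b := by
    rw [← hS.sum_accel_mul_h, Finset.mul_sum, ← Finset.sum_add_distrib]
    exact Finset.sum_congr rfl fun _ _ => by ring
  have h2 : ∑ b, S.P y b * S.nablaVec S.n y a b =
      ∑ b, S.nablaCov S.nDown y a b * S.raise S.P y b := by
    have e := fr.sum_lower_mul_comm (fun _ => S.nablaVec S.n y a) (S.raise S.P)
    simp only [fr.lower_raise] at e
    simp only [hS.nablaCov_nDown]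
    refine Eq.trans ?_ e.symm
    exact Finset.sum_congr rfl fun _ _ => mul_comm _ _
  rw [Fields.lieCov_eq hS.symm_g, Finset.sum_add_distrib, h2, hS.eps_P_vorticity, h1,
    hS.cattaneo_stress, hS.sum_nablaMixed_stress_trace_mul_n, hS.residual_mul_n,
    Fields.residual, hS.div_energyMomentum, fr.lorentz_force]
  ring

/-- The defect of the charge law is the divergence of the current. -/
theorem charge_balance (hS : IsRegularAt S y) :
    S.lieScalar S.ρ y -
    ((∑ a, S.accel y a * S.lower S.J y a) - S.expansion y * S.ρ y
      + ∑ a, S.cattaneoVec S.J y a a) = ∑ a, S.nablaVec S.j y a a := by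
  obtain ⟨_, _, fr⟩ := hS.frame.self_of_nhds
  have dρ := hS.diff_ρ
  have dn := hS.diff_n
  have h1 : ∀ a, S.nablaVec S.j y a a =
      pd S.ρ y a * S.n y a + S.ρ y * S.nablaVec S.n y a a - S.nablaVec S.J y a a := by
    intro a
    rw [← Fields.nablaVec_smul dρ dn, ← Fields.nablaVec_sub (fun _ => by fun_prop) hS.diff_J]
    refine Fields.nablaVec_congr (hS.frame.mono fun z ⟨_, _, fr⟩ => funext fun b => ?_) _ _
    rw [fr.J_eq]; ring
  rw [hS.cattaneo_divergence hS.diff_J (hS.frame.mono fun _ ⟨_, _, fr⟩ => fr.nDown_mul_J),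
    fr.sum_lower_mul_comm]
  simp only [h1, Finset.sum_sub_distrib, Finset.sum_add_distrib, ← Finset.mul_sum,
    Fields.lieScalar, Fields.expansion]
  simp only [mul_comm (S.n y _)]
  ring

/-- At a single point the two systems are equivalent, because a covector is zero if and only if its
component along `n` and its spatial projection are. -/
theorem covariantLaws_iff (hS : IsRegularAt S y) :
    S.CovariantLaws y ↔ S.EnergyLaw y ∧ S.MomentumLaw y ∧ S.ChargeLaw y := by
  have h1 : S.CovariantLaws y ↔ (∀ a, S.residual y a = 0) ∧ ∑ a, S.nablaVec S.j y a a = 0 := by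
    simp only [Fields.CovariantLaws, Fields.residual, sub_eq_zero]
  have h2 : S.EnergyLaw y ↔ ∑ a, S.residual y a * S.n y a = 0 := by
    rw [Fields.EnergyLaw, ← sub_eq_zero, hS.energy_balance, neg_eq_zero]
  have h3 : S.MomentumLaw y ↔
      ∀ a, S.residual y a + S.nDown y a * ∑ b, S.residual y b * S.n y b = 0 := by
    simp only [← hS.momentum_balance, sub_eq_zero, Fields.MomentumLaw]
  have h4 : S.ChargeLaw y ↔ ∑ a, S.nablaVec S.j y a a = 0 := by
    rw [Fields.ChargeLaw, ← sub_eq_zero, hS.charge_balance]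
  rw [h1, h2, h3, h4]
  constructor
  · rintro ⟨h, hc⟩
    simp [h, hc]
  · rintro ⟨hE, hM, hc⟩
    refine ⟨fun a => ?_, hc⟩
    simpa [hE] using hM a

end IsRegularAt

/-! ### Existence of adapted frames -/

/-- The Minkowski metric. -/
def minkowski : Matrix (Fin 4) (Fin 4) ℝ := Matrix.diagonal minkSign

theorem minkowski_mul_self : minkowski * minkowski = 1 := by
  rw [minkowski, Matrix.diagonal_mul_diagonal, ← Matrix.diagonal_one]
  congr 1
  funext i
  by_cases h : i = 0 <;> simp [minkSign, h]

theorem det_minkowski : minkowski.det = -1 := by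
  simp [minkowski, minkSign]

theorem pull₂_eq (M G : Matrix (Fin 4) (Fin 4) ℝ) (i k : Fin 4) :
    pull₂ M G i k = (M.transpose * G * M) i k := by
  simp only [pull₂, pull, Matrix.mul_apply, Matrix.transpose_apply, Finset.sum_mul]
  rw [Finset.sum_comm]
  exact Finset.sum_congr rfl fun _ _ => Finset.sum_congr rfl fun _ _ => by ring

/-- Every unit timelike vector is the first column of a Lorentz transformation. -/
theorem exists_lorentz_transformation (c : Fin 4 → ℝ)
    (hc : -c 0 ^ 2 + c 1 ^ 2 + c 2 ^ 2 + c 3 ^ 2 = -1) :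
    ∃ Λ : Matrix (Fin 4) (Fin 4) ℝ, Λ.transpose * minkowski * Λ = minkowski ∧
      ∀ i, Λ i 0 = c i := by
  obtain ⟨s, hs, hsc⟩ : ∃ s : ℝ, s ^ 2 - 1 = 0 ∧ 0 ≤ s * c 0 := by
    rcases le_total 0 (c 0) with h | h
    · exact ⟨1, by norm_num, by linarith⟩
    · exact ⟨-1, by norm_num, by linarith⟩
  obtain ⟨r, hr⟩ : ∃ r : ℝ, r * (1 + s * c 0) - 1 = 0 :=
    ⟨(1 + s * c 0)⁻¹, by rw [inv_mul_cancel₀ (by linarith), sub_self]⟩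
  have hv : c 1 ^ 2 + c 2 ^ 2 + c 3 ^ 2 - (c 0 ^ 2 - 1) = 0 := by linarith
  -- A boost, composed with a time reflection if `c 0 < 0`: `s` is the sign of `c 0`, and
  -- `r = 1 / (1 + |c 0|)`.
  refine ⟨!![c 0, s * c 1, s * c 2, s * c 3;
    c 1, 1 + r * c 1 * c 1, r * c 1 * c 2, r * c 1 * c 3;
    c 2, r * c 2 * c 1, 1 + r * c 2 * c 2, r * c 2 * c 3;
    c 3, r * c 3 * c 1, r * c 3 * c 2, 1 + r * c 3 * c 3], ?_, fun i => by fin_cases i <;> rfl⟩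
  generalize c 0 = c₀ at *
  generalize c 1 = c₁ at *
  generalize c 2 = c₂ at *
  generalize c 3 = c₃ at *
  -- `h0` makes the spacelike columns orthogonal to the timelike one, `h1` makes them orthonormal.
  have h0 : ∀ v : ℝ, v * (1 - c₀ * s + r * (c₁ ^ 2 + c₂ ^ 2 + c₃ ^ 2)) = 0 := fun v => by
    linear_combination v * (r * hv - r * c₀ ^ 2 * hs + (s * c₀ - 1) * hr)
  have h1 : ∀ v : ℝ, v * (-s ^ 2 + 2 * r + r ^ 2 * (c₁ ^ 2 + c₂ ^ 2 + c₃ ^ 2)) = 0 := fun v => by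
    linear_combination v * (-hs + r ^ 2 * hv - r ^ 2 * c₀ ^ 2 * hs + (r * s * c₀ + 1 - r) * hr)
  ext i k
  fin_cases i <;> fin_cases k <;>
    simp [minkowski, Matrix.mul_apply, Fin.sum_univ_four, minkSign, Matrix.diagonal_apply]
  · linear_combination hc
  · linear_combination h0 c₁
  · linear_combination h0 c₂
  · linear_combination h0 c₃
  · linear_combination h0 c₁
  · linear_combination h1 (c₁ * c₁)
  · linear_combination h1 (c₁ * c₂)
  · linear_combination h1 (c₁ * c₃)
  · linear_combination h0 c₂
  · linear_combination h1 (c₂ * c₁)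
  · linear_combination h1 (c₂ * c₂)
  · linear_combination h1 (c₂ * c₃)
  · linear_combination h0 c₃
  · linear_combination h1 (c₃ * c₁)
  · linear_combination h1 (c₃ * c₂)
  · linear_combination h1 (c₃ * c₃)

theorem isUnit_det_of_congr_minkowski {K G : Matrix (Fin 4) (Fin 4) ℝ}
    (h : K.transpose * G * K = minkowski) : IsUnit K.det := by
  have h2 := congrArg Matrix.det h
  rw [Matrix.det_mul, det_minkowski] at h2
  refine isUnit_iff_ne_zero.2 fun h0 => ?_
  rw [h0, mul_zero] at h2
  norm_num at h2

/-- An orthonormal frame can be boosted so that its timelike vector is a given unit timelike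
vector. -/
theorem exists_frame_through {K G : Matrix (Fin 4) (Fin 4) ℝ} (v : Fin 4 → ℝ)
    (hK : K.transpose * G * K = minkowski) (hv : ∑ a, ∑ b, v a * v b * G a b = -1) :
    ∃ M : Matrix (Fin 4) (Fin 4) ℝ, M.transpose * G * M = minkowski ∧ ∀ a, M a 0 = v a := by
  have hu := isUnit_det_of_congr_minkowski hK
  set c := K⁻¹.mulVec v with hc
  have hKc : K.mulVec c = v := by
    rw [hc, Matrix.mulVec_mulVec, Matrix.mul_nonsing_inv _ hu, Matrix.one_mulVec]
  have h1 : dotProduct c (minkowski.mulVec c) = -1 := by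
    rw [← hK, ← Matrix.mulVec_mulVec, ← Matrix.mulVec_mulVec, hKc, Matrix.mulVec_transpose,
      dotProduct_comm, ← Matrix.dotProduct_mulVec, hKc, ← hv]
    simp only [Matrix.mulVec, dotProduct, Finset.sum_mul]
    exact Finset.sum_congr rfl fun _ _ => Finset.sum_congr rfl fun _ _ => by ring
  obtain ⟨Λ, hΛ, hΛ0⟩ := exists_lorentz_transformation c (by
    rw [← h1]
    simp [minkowski, dotProduct, Fin.sum_univ_four, Matrix.mulVec_diagonal, minkSign]
    ring)
  refine ⟨K * Λ, ?_, fun a => ?_⟩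
  · rw [Matrix.transpose_mul]
    calc Λ.transpose * K.transpose * G * (K * Λ)
        = Λ.transpose * (K.transpose * G * K) * Λ := by simp only [Matrix.mul_assoc]
      _ = minkowski := by rw [hK, hΛ]
  · rw [← hKc, Matrix.mul_apply]
    simp only [hΛ0]
    rfl

theorem exists_isAdaptedFrame {S : Fields} {y : Coord} {K : Matrix (Fin 4) (Fin 4) ℝ}
    (hK : K.transpose * S.g y * K = minkowski)
    (hn : ∑ a, ∑ b, S.n y a * S.n y b * S.g y a b = -1)
    (hη : ∀ a b c d, S.η y a b c d = S.η y 0 1 2 3 * leviCivita a b c d)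
    (hsq : S.η y 0 1 2 3 ^ 2 = - (S.g y).det) (hF : ∀ a b, S.F y a b = - S.F y b a) :
    ∃ M σ, IsAdaptedFrame S y M σ := by
  obtain ⟨M, hM, hM0⟩ := exists_frame_through (S.n y) hK hn
  have hu := isUnit_det_of_congr_minkowski hM
  refine ⟨M, S.η y 0 1 2 3 * M.det, hu, fun a b => ?_, fun i k => ?_, fun a => (hM0 a).symm, hη,
    fun i k l m => ?_, ?_, fun i k => ?_⟩
  · have h1 : S.g y * (M * minkowski * M.transpose) = 1 := by
      have hut : IsUnit M.transpose.det := by rwa [Matrix.det_transpose]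
      have h2 : M.transpose * (S.g y * (M * minkowski * M.transpose)) = M.transpose := by
        calc M.transpose * (S.g y * (M * minkowski * M.transpose))
            = (M.transpose * S.g y * M) * minkowski * M.transpose := by
              simp only [Matrix.mul_assoc]
          _ = M.transpose := by rw [hM, minkowski_mul_self, Matrix.one_mul]
      calc S.g y * (M * minkowski * M.transpose)
          = M.transpose⁻¹ * (M.transpose * (S.g y * (M * minkowski * M.transpose))) := by
            rw [Matrix.nonsing_inv_mul_cancel_left _ _ hut]
        _ = 1 := by rw [h2, Matrix.nonsing_inv_mul _ hut]
    rw [Fields.gUp, Matrix.inv_eq_right_inv h1, Matrix.mul_apply]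
    refine Finset.sum_congr rfl fun i _ => ?_
    rw [minkowski, Matrix.mul_diagonal, Matrix.transpose_apply]
    ring
  · rw [pull₂_eq, hM, minkowski, Matrix.diagonal_apply]
  · rw [← pull₄_leviCivita]
    simp only [← hη]
  · have h2 := congrArg Matrix.det hM
    rw [Matrix.det_mul, Matrix.det_mul, Matrix.det_transpose, det_minkowski] at h2
    linear_combination M.det ^ 2 * hsq - h2
  · have h : pull₂ M (S.F y) i k = pull M (fun a => pull M (fun b => -S.F y b a) k) i := by
      simp only [← hF]; rfl
    rw [h, pull_comm]
    simp [pull₂, pull]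

/-! ### Fields in a chart -/

section Charts

variable {V : Type*} [TopologicalSpace V] [ChartedSpace Coord V]

theorem alternating_apply_basis {E : Type*} [AddCommGroup E] [Module ℝ E]
    (b : Module.Basis (Fin 4) ℝ E) (f : E [⋀^Fin 4]→ₗ[ℝ] ℝ) (v : Fin 4 → Fin 4) :
    f (fun i => b (v i)) = f b * leviCivita (v 0) (v 1) (v 2) (v 3) := by
  have h := det_submatrix_eq_leviCivita 1 v
  rw [Matrix.det_one, one_mul, Matrix.transpose_one] at h
  have h2 : b.toMatrix (fun i => b (v i)) =
      ((1 : Matrix (Fin 4) (Fin 4) ℝ).submatrix v id).transpose := by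
    ext i k
    simp [Module.Basis.toMatrix_apply, Matrix.one_apply, Finsupp.single_apply]
  rw [← h, ← Matrix.det_transpose, ← h2, ← Module.Basis.det_apply]
  exact DFunLike.congr_fun (f.eq_smul_basis_det b) _

theorem bilinear_apply_sum {E : Type*} [AddCommGroup E] [Module ℝ E]
    (f : MultilinearMap ℝ (fun _ : Fin 2 => E) ℝ) (b : Fin 4 → E) (u w : Fin 4 → ℝ) :
    f ![∑ a, u a • b a, ∑ a, w a • b a] = ∑ a, ∑ c, u a * w c * f ![b a, b c] := by
  have h0 : ∀ x z, f.toLinearMap ![0, z] 0 x = f ![x, z] := fun x z => by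
    rw [MultilinearMap.toLinearMap_apply]
    congr 1
    ext i; fin_cases i <;> simp
  have h1 : ∀ x z, f.toLinearMap ![x, 0] 1 z = f ![x, z] := fun x z => by
    rw [MultilinearMap.toLinearMap_apply]
    congr 1
    ext i; fin_cases i <;> simp
  rw [← h0, map_sum]
  refine Finset.sum_congr rfl fun a _ => ?_
  rw [map_smul, h0, ← h1, map_sum, Finset.smul_sum]
  refine Finset.sum_congr rfl fun c _ => ?_
  rw [map_smul, h1, smul_smul, smul_eq_mul]

theorem isInvertible_mfderiv_symm {e : OpenPartialHomeomorph V Coord}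
    (he : e ∈ IsManifold.maximalAtlas (𝓡 4) ∞ V) {y : Coord} (hy : y ∈ e.target) :
    (mfderiv 𝓘(ℝ, Coord) (𝓡 4) e.symm y).IsInvertible := by
  have h : e.MDifferentiable (𝓡 4) (𝓡 4) :=
    ⟨(contMDiffOn_of_mem_maximalAtlas he).mdifferentiableOn (by simp),
      (contMDiffOn_symm_of_mem_maximalAtlas he).mdifferentiableOn (by simp)⟩
  exact ⟨h.symm.mfderiv hy, rfl⟩

/-- The coordinate vectors form a basis of the tangent space, and `vecComp` gives the components in
that basis. -/
theorem exists_basis_coordVec {e : OpenPartialHomeomorph V Coord}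
    (he : e ∈ IsManifold.maximalAtlas (𝓡 4) ∞ V) {y : Coord} (hy : y ∈ e.target) :
    ∃ b : Module.Basis (Fin 4) ℝ (TangentSpace (𝓡 4) (e.symm y)), (∀ a, b a = coordVec e y a) ∧
      ∀ (X : (x : V) → TangentSpace (𝓡 4) x) a, vecComp e X y a = b.repr (X (e.symm y)) a := by
  obtain ⟨L, hL⟩ := isInvertible_mfderiv_symm he hy
  refine ⟨(EuclideanSpace.basisFun (Fin 4) ℝ).toBasis.map L.toLinearEquiv, fun a => ?_,
    fun X a => ?_⟩
  · rw [coordVec, ← hL]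
    change L ((EuclideanSpace.basisFun (Fin 4) ℝ).toBasis a) = L (EuclideanSpace.single a 1)
    rw [OrthonormalBasis.coe_toBasis, EuclideanSpace.basisFun_apply]
  · rw [vecComp, VectorField.mpullback_apply, ← hL, ContinuousLinearMap.inverse_equiv]
    simp
    rfl

theorem differentiableAt_vecComp [IsManifold (𝓡 4) ∞ V] {e : OpenPartialHomeomorph V Coord}
    (he : e ∈ IsManifold.maximalAtlas (𝓡 4) ∞ V) {y : Coord} (hy : y ∈ e.target)
    {X : (x : V) → TangentSpace (𝓡 4) x} (hX : IsSmoothVec X) (a : Fin 4) :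
    DifferentiableAt ℝ (fun z => vecComp e X z a) y := by
  have h1 : ContMDiffAt (𝓡 4) (𝓡 4) ∞ e.symm y :=
    (contMDiffOn_symm_of_mem_maximalAtlas he).contMDiffAt (e.open_target.mem_nhds hy)
  have h2 := ContMDiffAt.mpullback_vectorField_preimage (m := 1) (n := 2) (f := e.symm)
    ((hX (e.symm y)).of_le (by exact_mod_cast le_top)) (h1.of_le ENat.LEInfty.out)
    (isInvertible_mfderiv_symm he hy) (by norm_num)
  have h3 := (contMDiffAt_vectorSpace_iff_contDiffAt.1 h2).differentiableAt (by norm_num)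
  exact (differentiableAt_euclidean.1 h3) a

theorem differentiableAt_covComp {e : OpenPartialHomeomorph V Coord}
    (he : e ∈ IsManifold.maximalAtlas (𝓡 4) ∞ V) {y : Coord} (hy : y ∈ e.target) {k : ℕ}
    {T : (x : V) → MultilinearMap ℝ (fun _ : Fin k => TangentSpace (𝓡 4) x) ℝ}
    (hT : IsSmoothCov T) (i : Fin k → Fin 4) :
    DifferentiableAt ℝ (fun z => T (e.symm z) (fun l => coordVec e z (i l))) y :=
  ((hT e he i).contDiffAt (e.open_target.mem_nhds hy)).differentiableAt (by simp)

theorem isRegularAt_fieldsIn [IsManifold (𝓡 4) ∞ V]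
    {g : (x : V) → MultilinearMap ℝ (fun _ : Fin 2 => TangentSpace (𝓡 4) x) ℝ}
    (hg : IsLorentzMetric g)
    {η : (x : V) → TangentSpace (𝓡 4) x [⋀^Fin 4]→ₗ[ℝ] ℝ} (hη : IsVolumeElement g η)
    {n : (x : V) → TangentSpace (𝓡 4) x}
    (hn : IsSmoothVec n) (hn_unit : ∀ x, g x ![n x, n x] = -1)
    {F : (x : V) → TangentSpace (𝓡 4) x [⋀^Fin 2]→ₗ[ℝ] ℝ}
    (hF : IsSmoothCov (fun x => (F x).toMultilinearMap))
    {j : (x : V) → TangentSpace (𝓡 4) x} (hj : IsSmoothVec j)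
    {e : OpenPartialHomeomorph V Coord} (he : e ∈ IsManifold.maximalAtlas (𝓡 4) ∞ V)
    {y : Coord} (hy : y ∈ e.target) : IsRegularAt (fieldsIn e g η n F j) y where
  frame := by
    filter_upwards [e.open_target.mem_nhds hy] with z hz
    obtain ⟨b, hb, hX⟩ := exists_basis_coordVec he hz
    obtain ⟨c, hc⟩ := hg.signature (e.symm z)
    have hgb : ∀ a k, (fieldsIn e g η n F j).g z a k = g (e.symm z) ![b a, b k] := fun a k => by
      simp only [hb]; rfl
    have hηb : ∀ v : Fin 4 → Fin 4, (fieldsIn e g η n F j).η z (v 0) (v 1) (v 2) (v 3) =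
        η (e.symm z) (fun i => b (v i)) := fun v => by
      have : (fun i => b (v i)) = ![b (v 0), b (v 1), b (v 2), b (v 3)] := by
        funext i; fin_cases i <;> rfl
      rw [this]; simp only [hb]; rfl
    refine exists_isAdaptedFrame (K := Matrix.of fun a i => b.repr (c i) a) ?_ ?_ ?_ ?_ ?_
    · ext i k
      rw [← pull₂_eq, minkowski, Matrix.diagonal_apply]
      refine Eq.trans ?_ ((hc i k).trans ?_)
      · rw [← b.sum_repr (c i), ← b.sum_repr (c k), bilinear_apply_sum]
        simp only [pull₂, pull, hgb, Finset.sum_mul]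
        exact Finset.sum_congr rfl fun _ _ => Finset.sum_congr rfl fun _ _ => by
          simp only [Matrix.of_apply]; ring
      · rfl
    · rw [← hn_unit (e.symm z), ← b.sum_repr (n (e.symm z)), bilinear_apply_sum]
      simp only [hgb]
      have : ∀ a, (fieldsIn e g η n F j).n z a = b.repr (n (e.symm z)) a := hX n
      simp only [this]
    · intro a₀ a₁ a₂ a₃
      have h1 := hηb ![a₀, a₁, a₂, a₃]
      have h2 := hηb id
      rw [alternating_apply_basis] at h1
      exact h1.trans (congrArg (· * _) h2.symm)
    · rw [show (fieldsIn e g η n F j).η z 0 1 2 3 = _ from hηb id]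
      refine (hη.sq_eq (e.symm z) _).trans ?_
      congr 2
      ext a k
      exact (hgb a k).symm
    · intro a k
      have h := (F (e.symm z)).map_swap ![coordVec e z a, coordVec e z k]
        (show (0 : Fin 2) ≠ 1 by decide)
      have h2 : ![coordVec e z a, coordVec e z k] ∘ Equiv.swap 0 1 =
          ![coordVec e z k, coordVec e z a] := by
        funext i; fin_cases i <;> rfl
      rw [h2] at h
      change F (e.symm z) _ = - F (e.symm z) _
      rw [h, neg_neg]
  diff_g a k := by
    have h : ∀ z, (fun l => coordVec e z (![a, k] l)) = ![coordVec e z a, coordVec e z k] :=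
      fun z => by funext i; fin_cases i <;> rfl
    have h2 := differentiableAt_covComp he hy hg.smooth ![a, k]
    simp only [h] at h2
    exact h2
  diff_η a₀ a₁ a₂ a₃ := by
    have h : ∀ z, (fun l => coordVec e z (![a₀, a₁, a₂, a₃] l)) =
        ![coordVec e z a₀, coordVec e z a₁, coordVec e z a₂, coordVec e z a₃] :=
      fun z => by funext i; fin_cases i <;> rfl
    have h2 := differentiableAt_covComp he hy hη.smooth ![a₀, a₁, a₂, a₃]
    simp only [h] at h2
    exact h2
  diff_n := differentiableAt_vecComp he hy hn
  diff_F a k := by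
    have h : ∀ z, (fun l => coordVec e z (![a, k] l)) = ![coordVec e z a, coordVec e z k] :=
      fun z => by funext i; fin_cases i <;> rfl
    have h2 := differentiableAt_covComp he hy hF ![a, k]
    simp only [h] at h2
    exact h2
  diff_j := differentiableAt_vecComp he hy hj

end Charts

end Poynting

end

theorem mainTheorem4
    {V : Type*} [TopologicalSpace V] [ChartedSpace Poynting.Coord V] [IsManifold (𝓡 4) ∞ V]
    (g : (x : V) → MultilinearMap ℝ (fun _ : Fin 2 => TangentSpace (𝓡 4) x) ℝ)
    (hg : Poynting.IsLorentzMetric g)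
    (η : (x : V) → TangentSpace (𝓡 4) x [⋀^Fin 4]→ₗ[ℝ] ℝ)
    (hη : Poynting.IsVolumeElement g η)
    (n : (x : V) → TangentSpace (𝓡 4) x)
    (hn : Poynting.IsSmoothVec n) (hn_unit : ∀ x, g x ![n x, n x] = -1)
    (F : (x : V) → TangentSpace (𝓡 4) x [⋀^Fin 2]→ₗ[ℝ] ℝ)
    (hF : Poynting.IsSmoothCov (fun x => (F x).toMultilinearMap))
    (j : (x : V) → TangentSpace (𝓡 4) x)
    (hj : Poynting.IsSmoothVec j) :
    (∀ e ∈ IsManifold.maximalAtlas (𝓡 4) ∞ V, ∀ p ∈ e.source,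
      (Poynting.fieldsIn e g η n F j).CovariantLaws (e p)) ↔
    (∀ e ∈ IsManifold.maximalAtlas (𝓡 4) ∞ V, ∀ p ∈ e.source,
      (Poynting.fieldsIn e g η n F j).EnergyLaw (e p) ∧
      (Poynting.fieldsIn e g η n F j).MomentumLaw (e p) ∧
      (Poynting.fieldsIn e g η n F j).ChargeLaw (e p)) :=
  forall₂_congr fun _ he => forall₂_congr fun _ hp =>
    (Poynting.isRegularAt_fieldsIn hg hη hn hn_unit hF hj he
      (OpenPartialHomeomorph.map_source _ hp)).covariantLaws_iff
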